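/- Conventions. Rings are associative with $1$, not necessarily commutative. A prime ideal of a ring $A$ is a proper two-sided ideal $P$ such that $xAy\subseteq P$ implies $x\in P$ or $y\in P$; ${\rm Spec}(A)$ is the set of prime ideals, $\min(I)$ the set of primes minimal over an ideal $I$, $\min(A)=\min(0)$, and $\mathfrak n_A$ the prime radical (the intersection of all primes). A multiplicative set contains $1$ and does not contain $0$. An element $x\in A$ is normal if $Ax=xA$. ${\rm Den}(A,0)$ is the set of left and right denominator sets of $A$ that consist of regular elements; for $T\in{\rm Den}(A,0)$ and a left ideal $I$ of $A$, $T^{-1}A$ is the left Ore localization and $T^{-1}I=\{t^{-1}a\mid t\in T,\ a\in I\}$. For a multiplicative set $S\subseteq R$, $R\langle S^{-1}\rangle$ is the quotient of the ring $R\langle x_s\mid s\in S\rangle$ (freely generated by the ring $R$ and noncommuting indeterminates $x_s$) by the two-sided ideal generated by all $sx_s-1$ and $x_ss-1$. **Theorem.** Let $R$ be a ring, let $S\subseteq R$ be a multiplicative set generated (as a monoid) by normal elements of $R$, and put $\mathfrak a=\{r\in R\mid srt=0\text{ for some }s,t\in S\}$, an ideal of $R$. Suppose that $\min(\mathfrak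 a)$ is finite. Let $\pi:R\to\overline R=R/\mathfrak a$ and $\widetilde\pi:\overline R\to\widetilde R=\overline R/\mathfrak n_{\overline R}$ be the projections, $\overline S=\pi(S)$, $\widetilde{\overline S}=\widetilde\pi(\overline S)$, and for $\mathfrak p\in\min(\mathfrak a)$ let $\overline{\mathfrak p}=\pi(\mathfrak p)$, $\widetilde{\overline{\mathfrak p}}=\widetilde\pi(\overline{\mathfrak p})$ and $\pi_{\mathfrak p}:R\to R/\mathfrak p$ the projection. Then $\mathfrak a$ is the kernel of $R\to R\langle S^{-1}\rangle$, $\overline S\in{\rm Den}(\overline R,0)$, and there is an isomorphism $R\langle S^{-1}\rangle\simeq\overline S^{-1}\overline R$ compatible with the maps from $R$; identify these rings by it. Moreover: 1. The map $\min(\mathfrak a)\to{\rm Spec}(R\langle S^{-1}\rangle)={\rm Spec}(\overline S^{-1}\overline R)$, $\mathfrak p\mapsto\overline S^{-1}\overline{\mathfrak p}$, is well defined and injective, and $\mathfrak n_{\overline S^{-1}\overline R}\subseteq\overline S^{-1}\mathfrak n_{\overline R}$. 2. $\widetilde{\overline S}\in{\rm Den}(\widetilde R,0)$, $\overline S^{-1}\mathfrak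 n_{\overline R}$ is a two-sided ideal, the natural map $\overline S^{-1}\overline R\to\widetilde{\overline S}^{-1}\widetilde R$ induces an isomorphism $\overline S^{-1}\overline R/\overline S^{-1}\mathfrak n_{\overline R}\simeq\widetilde{\overline S}^{-1}\widetilde R$, and $\mathfrak p\mapsto\widetilde{\overline S}^{-1}\widetilde{\overline{\mathfrak p}}$ is a bijection $\min(\mathfrak a)\to\min(\widetilde{\overline S}^{-1}\widetilde R)$. 3. For each $\mathfrak p\in\min(\mathfrak a)$: $\pi_{\mathfrak p}(S)\in{\rm Den}(R/\mathfrak p,0)$, the left ideals $\overline S^{-1}\overline{\mathfrak p}$ and $\widetilde{\overline S}^{-1}\widetilde{\overline{\mathfrak p}}$ are two-sided, and there are ring isomorphisms $$\pi_{\mathfrak p}(S)^{-1}(R/\mathfrak p)\simeq\widetilde{\overline S}^{-1}\widetilde R/\widetilde{\overline S}^{-1}\widetilde{\overline{\mathfrak p}}\simeq\overline S^{-1}\overline R/\overline S^{-1}\overline{\mathfrak p}$$ and a commutative diagram of ring homomorphisms, in which the composition of the top row is $\pi_{\mathfrak p}$, the three arrows from the top row to the second row are the localization maps, the arrows onto factor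 rings are the projections, and the arrows marked $\simeq$ are isomorphisms, namely those of this part and of part 2: $$\begin{array}{ccccccc} R & \stackrel{\pi}{\rightarrow} & \overline R & \stackrel{\widetilde\pi}{\rightarrow} & \widetilde R & \rightarrow & R/\mathfrak p\\ & & \downarrow & & \downarrow & & \downarrow\\ & & \overline S^{-1}\overline R & \rightarrow & \widetilde{\overline S}^{-1}\widetilde R & \rightarrow & \pi_{\mathfrak p}(S)^{-1}(R/\mathfrak p)\\ & & \downarrow & \nearrow_{\simeq} & \downarrow & \nearrow_{\simeq} & \\ \overline S^{-1}\overline R/\mathfrak n_{\overline S^{-1}\overline R} & \rightarrow & \overline S^{-1}\overline R/\overline S^{-1}\mathfrak n_{\overline R} & \rightarrow & \widetilde{\overline S}^{-1}\widetilde R/\widetilde{\overline S}^{-1}\widetilde{\overline{\mathfrak p}} & & \\ & & \downarrow & \nearrow_{\simeq} & & & \\ & & \overline S^{-1}\overline R/\overline S^{-1}\overline{\mathfrak p} & & & & \end{array}$$ 4. Suppose that $\mathfrak n_{\overline R}$ is a nilpotent ideal. Then (a) $\mathfrak p\mapsto\overline S^{-1}\overline{\mathfrak p}$ is a bijection $\min(\mathfrak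 a)\to\min(R\langle S^{-1}\rangle)=\min(\overline S^{-1}\overline R)$; (b) $\overline S^{-1}\mathfrak n_{\overline R}=\mathfrak n_{\overline S^{-1}\overline R}$, and there are isomorphisms $\overline S^{-1}\overline R/\overline S^{-1}\mathfrak n_{\overline R}\simeq\overline S^{-1}\overline R/\mathfrak n_{\overline S^{-1}\overline R}\simeq\widetilde{\overline S}^{-1}\widetilde R$, compatible with the natural maps from $\overline S^{-1}\overline R$. -/

import Mathlib

namespace MinPrimesLoc

universe u v

section Primes

variable {A : Type u} [Ring A]

/-- A prime ideal of a (not necessarily commutative) ring: a proper two-sided ideal `P` such that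
`x A y ⊆ P` implies `x ∈ P` or `y ∈ P`. -/
structure IsPrimeIdeal (P : Ideal A) : Prop where
  twoSided : P.IsTwoSided
  ne_top : P ≠ ⊤
  mem_or_mem : ∀ x y : A, (∀ r : A, x * r * y ∈ P) → x ∈ P ∨ y ∈ P

variable (A) in
/-- The prime spectrum, as a set of ideals. -/
def primeSpec : Set (Ideal A) := {P | IsPrimeIdeal P}

/-- The set `min(I)` of prime ideals that are minimal over the ideal `I`. -/
def minPrimesOver (I : Ideal A) : Set (Ideal A) :=
  {P | Minimal (fun Q : Ideal A => IsPrimeIdeal Q ∧ I ≤ Q) P}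

variable (A) in
/-- The set `min(A)` of minimal primes of the ring `A`. -/
def minPrimes : Set (Ideal A) := {P | Minimal (fun Q : Ideal A => IsPrimeIdeal Q) P}

variable (A) in
/-- The prime radical: the intersection of all prime ideals. -/
def primeRadical : Ideal A := sInf (primeSpec A)

instance primeRadical_isTwoSided : (primeRadical A).IsTwoSided where
  mul_mem_of_left {a} b ha := by
    rw [primeRadical, Submodule.mem_sInf] at ha ⊢
    intro P hP
    have := (show IsPrimeIdeal P from hP).twoSided
    exact Ideal.mul_mem_right b P (ha P hP)

instance minPrimesOver_isTwoSided {I : Ideal A} (p : minPrimesOver I) :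
    (p : Ideal A).IsTwoSided :=
  (Minimal.prop (show Minimal (fun Q : Ideal A => IsPrimeIdeal Q ∧ I ≤ Q) p from p.2)).1.twoSided

/-- A (two-sided) ideal `I` is nilpotent: for some `m`, every product of `m` of its elements is
zero. -/
def IsNilpotentIdeal (I : Ideal A) : Prop :=
  ∃ m : ℕ, ∀ l : List A, l.length = m → (∀ x ∈ l, x ∈ I) → l.prod = 0

end Primes

section Ore

variable {A : Type u} [Ring A]

/-- A left Ore set: a multiplicative set (`1 ∈ T`, `0 ∉ T`) with `T r ∩ A s ≠ ∅` for all
`r ∈ A`, `s ∈ T`. -/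
structure IsLeftOre (T : Submonoid A) : Prop where
  zero_notMem : (0 : A) ∉ T
  ore : ∀ r : A, ∀ s ∈ T, ∃ t ∈ T, ∃ a : A, t * r = a * s

/-- A right Ore set. -/
structure IsRightOre (T : Submonoid A) : Prop where
  zero_notMem : (0 : A) ∉ T
  ore : ∀ r : A, ∀ s ∈ T, ∃ t ∈ T, ∃ a : A, r * t = s * a

/-- An Ore set is a left and right Ore set. -/
structure IsOre (T : Submonoid A) : Prop where
  left : IsLeftOre T
  right : IsRightOre T

/-- A left denominator set. -/
structure IsLeftDen (T : Submonoid A) : Prop extends IsLeftOre T where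
  reversible : ∀ r : A, ∀ s ∈ T, r * s = 0 → ∃ t ∈ T, t * r = 0

/-- A right denominator set. -/
structure IsRightDen (T : Submonoid A) : Prop extends IsRightOre T where
  reversible : ∀ r : A, ∀ s ∈ T, s * r = 0 → ∃ t ∈ T, r * t = 0

/-- `T ∈ Den(A, I)`: `T` is a left and right denominator set with
`{r | T r ∋ 0} = {r | r T ∋ 0} = I`. -/
structure IsDen (T : Submonoid A) (I : Ideal A) : Prop where
  left : IsLeftDen T
  right : IsRightDen T
  assLeft : ∀ r : A, r ∈ I ↔ ∃ s ∈ T, s * r = 0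
  assRight : ∀ r : A, r ∈ I ↔ ∃ s ∈ T, r * s = 0

/-- The data of Mathlib's Ore localization, chosen for a left denominator set. -/
@[reducible] noncomputable def IsLeftDen.oreSet {T : Submonoid A} (h : IsLeftDen T) :
    OreLocalization.OreSet T where
  ore_right_cancel r₁ r₂ s hs := by
    obtain ⟨t, ht, h0⟩ := h.reversible (r₁ - r₂) s s.2 (by rw [sub_mul, hs, sub_self])
    exact ⟨⟨t, ht⟩, by rwa [mul_sub, sub_eq_zero] at h0⟩
  oreNum r s := (h.ore r s s.2).choose_spec.2.choose
  oreDenom r s := ⟨(h.ore r s s.2).choose, (h.ore r s s.2).choose_spec.1⟩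
  ore_eq r s := (h.ore r s s.2).choose_spec.2.choose_spec

/-- The left localization `T⁻¹A` of `A` at a left denominator set `T` (Mathlib's Ore
localization). -/
def Loc (T : Submonoid A) (h : IsLeftDen T) : Type u :=
  letI := h.oreSet
  OreLocalization T A

noncomputable instance Loc.instRing (T : Submonoid A) (h : IsLeftDen T) : Ring (Loc T h) :=
  letI := h.oreSet
  inferInstanceAs (Ring (OreLocalization T A))

/-- The canonical homomorphism `A → T⁻¹A`, `r ↦ r/1`. -/
noncomputable def Loc.of (T : Submonoid A) (h : IsLeftDen T) : A →+* Loc T h :=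
  letI := h.oreSet
  OreLocalization.numeratorRingHom

/-- The left fraction `s⁻¹ r`. -/
noncomputable def Loc.frac {T : Submonoid A} (h : IsLeftDen T) (s : T) (r : A) : Loc T h :=
  letI := h.oreSet
  OreLocalization.oreDiv r s

/-- The left ideal `T⁻¹I = {s⁻¹ a | s ∈ T, a ∈ I}` of `T⁻¹A`, for a left ideal `I` of `A`. -/
noncomputable def Loc.ideal {T : Submonoid A} (h : IsLeftDen T) (I : Ideal A) :
    Ideal (Loc T h) where
  carrier := {x | ∃ s : T, ∃ a ∈ I, x = Loc.frac h s a}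
  zero_mem' := ⟨1, 0, I.zero_mem, by
    let _ := h.oreSet
    exact (OreLocalization.zero_oreDiv (X := A) (1 : T)).symm⟩
  add_mem' := by
    rintro _ _ ⟨s, a, ha, rfl⟩ ⟨t, b, hb, rfl⟩
    let _ := h.oreSet
    obtain ⟨r', s', h1, h2⟩ := OreLocalization.oreDivAddChar' a b s t
    exact ⟨s' * s, s' • a + r' • b,
      I.add_mem (I.mul_mem_left _ ha) (I.mul_mem_left _ hb), h2⟩
  smul_mem' := by
    rintro c _ ⟨t, b, hb, rfl⟩
    let _ := h.oreSet
    change OreLocalization T A at c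
    induction c with
    | _ a s =>
      obtain ⟨r', s', h1, h2⟩ := OreLocalization.oreDivSMulChar' a b s t
      exact ⟨s' * s, r' • b, I.mul_mem_left _ hb, h2⟩

/-- For an Ore set `S`, the ideal `{r | s r t = 0 for some s, t ∈ S}`. -/
def ass (S : Submonoid A) (h : IsOre S) : Ideal A where
  carrier := {r | ∃ s ∈ S, ∃ t ∈ S, s * r * t = 0}
  zero_mem' := ⟨1, S.one_mem, 1, S.one_mem, by simp⟩
  add_mem' := by
    rintro x y ⟨s₁, hs₁, t₁, ht₁, h₁⟩ ⟨s₂, hs₂, t₂, ht₂, h₂⟩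
    obtain ⟨s, hs, a, ha⟩ := h.left.ore s₁ s₂ hs₂
    obtain ⟨t, ht, b, hb⟩ := h.right.ore t₁ t₂ ht₂
    refine ⟨s * s₁, S.mul_mem hs hs₁, t₁ * t, S.mul_mem ht₁ ht, ?_⟩
    have e₁ : s * s₁ * x * (t₁ * t) = s * (s₁ * x * t₁) * t := by simp only [mul_assoc]
    have e₂ : s * s₁ * y * (t₁ * t) = a * (s₂ * y * t₂) * b := by
      rw [ha, hb]; simp only [mul_assoc]
    rw [mul_add, add_mul, e₁, e₂, h₁, h₂]; simp
  smul_mem' := by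
    rintro c x ⟨s, hs, t, ht, h0⟩
    obtain ⟨s', hs', a, ha⟩ := h.left.ore c s hs
    refine ⟨s', hs', t, ht, ?_⟩
    have : s' * (c • x) * t = a * (s * x * t) := by
      rw [smul_eq_mul, ← mul_assoc, ha]; simp only [mul_assoc]
    rw [this, h0, mul_zero]

instance ass_isTwoSided (S : Submonoid A) (h : IsOre S) : (ass S h).IsTwoSided where
  mul_mem_of_left {x} c := by
    rintro ⟨s, hs, t, ht, h0⟩
    obtain ⟨t', ht', a, ha⟩ := h.right.ore c t ht
    refine ⟨s, hs, t', ht', ?_⟩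
    have : s * (x * c) * t' = s * x * t * a := by
      rw [← mul_assoc, mul_assoc (s * x), ha]; simp only [mul_assoc]
    rw [this, h0, zero_mul]

/-- An element `x` is normal if `A x = x A`. -/
def IsNormalElt (x : A) : Prop :=
  {y : A | ∃ r : A, y = r * x} = {y : A | ∃ r : A, y = x * r}

/-- `S` is a multiplicative set (`1 ∈ S`, `0 ∉ S`) generated, as a multiplicative monoid, by
normal elements of the ring. -/
structure IsNormallyGenerated (S : Submonoid A) : Prop where
  zero_notMem : (0 : A) ∉ S
  exists_generators : ∃ X : Set A, (∀ x ∈ X, IsNormalElt x) ∧ S = Submonoid.closure X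

theorem IsNormallyGenerated.isNormalElt {S : Submonoid A} (h : IsNormallyGenerated S) :
    ∀ s ∈ S, IsNormalElt s := by
  obtain ⟨X, hX, rfl⟩ := h.exists_generators
  intro s hs
  induction hs using Submonoid.closure_induction with
  | mem x hx => exact hX x hx
  | one => simp [IsNormalElt]
  | mul x y _ _ hx hy =>
    rw [IsNormalElt, Set.ext_iff] at hx hy ⊢
    intro z
    constructor
    · rintro ⟨r, rfl⟩
      obtain ⟨a, ha⟩ := (hx (r * x)).1 ⟨r, rfl⟩
      obtain ⟨b, hb⟩ := (hy (a * y)).1 ⟨a, rfl⟩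
      exact ⟨b, by rw [← mul_assoc, ha, mul_assoc, hb, mul_assoc]⟩
    · rintro ⟨r, rfl⟩
      obtain ⟨a, ha⟩ := (hy (y * r)).2 ⟨r, rfl⟩
      obtain ⟨b, hb⟩ := (hx (x * a)).2 ⟨a, rfl⟩
      exact ⟨b, by rw [mul_assoc, ha, ← mul_assoc, hb, mul_assoc]⟩

theorem IsNormallyGenerated.isOre {S : Submonoid A} (h : IsNormallyGenerated S) : IsOre S where
  left := ⟨h.zero_notMem, fun r s hs =>
    ⟨s, hs, (Set.ext_iff.1 (h.isNormalElt s hs) (s * r)).2 ⟨r, rfl⟩⟩⟩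
  right := ⟨h.zero_notMem, fun r s hs =>
    ⟨s, hs, (Set.ext_iff.1 (h.isNormalElt s hs) (r * s)).1 ⟨r, rfl⟩⟩⟩

end Ore

section Universal

variable (A : Type u) [Ring A] (X : Type v)

/-- The relations making `A → ℤ⟨A ⊔ X⟩` a ring homomorphism. -/
inductive FreeExtRel : FreeAlgebra ℤ (A ⊕ X) → FreeAlgebra ℤ (A ⊕ X) → Prop
  | add (a b : A) : FreeExtRel (FreeAlgebra.ι ℤ (Sum.inl (a + b)))
      (FreeAlgebra.ι ℤ (Sum.inl a) + FreeAlgebra.ι ℤ (Sum.inl b))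
  | mul (a b : A) : FreeExtRel (FreeAlgebra.ι ℤ (Sum.inl (a * b)))
      (FreeAlgebra.ι ℤ (Sum.inl a) * FreeAlgebra.ι ℤ (Sum.inl b))
  | one : FreeExtRel (FreeAlgebra.ι ℤ (Sum.inl 1)) 1

/-- The ring `A⟨X⟩` freely generated by the ring `A` and the set `X` of noncommuting
indeterminates (which do not commute with `A` either). -/
def FreeExt : Type (max u v) := RingQuot (FreeExtRel A X)

noncomputable instance FreeExt.instRing : Ring (FreeExt A X) :=
  inferInstanceAs (Ring (RingQuot (FreeExtRel A X)))

variable {A X}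

/-- The indeterminate attached to `x : X`. -/
noncomputable def FreeExt.var (x : X) : FreeExt A X :=
  RingQuot.mkRingHom (FreeExtRel A X) (FreeAlgebra.ι ℤ (Sum.inr x))

variable (A X) in
/-- The ring homomorphism `A → A⟨X⟩`. -/
noncomputable def FreeExt.C : A →+* FreeExt A X :=
  RingHom.mk'
    { toFun := fun a => RingQuot.mkRingHom (FreeExtRel A X) (FreeAlgebra.ι ℤ (Sum.inl a))
      map_one' := (RingQuot.mkRingHom_rel FreeExtRel.one).trans (map_one _)
      map_mul' := fun a b => (RingQuot.mkRingHom_rel (FreeExtRel.mul a b)).trans (map_mul _ _ _) }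
    (fun a b => (RingQuot.mkRingHom_rel (FreeExtRel.add a b)).trans (map_add _ _ _))

variable (S : Submonoid A)

/-- The two-sided ideal of `A⟨x_s | s ∈ S⟩` generated by all `s x_s - 1` and `x_s s - 1`. -/
noncomputable def invIdeal : TwoSidedIdeal (FreeExt A S) :=
  TwoSidedIdeal.span
    ({y | ∃ s : S, y = FreeExt.C A S s * FreeExt.var s - 1} ∪
      {y | ∃ s : S, y = FreeExt.var s * FreeExt.C A S s - 1})

/-- The localization `A⟨S⁻¹⟩` of `A` at `S`. -/
def UnivLoc : Type u := (invIdeal S).ringCon.Quotient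

noncomputable instance UnivLoc.instRing : Ring (UnivLoc S) :=
  inferInstanceAs (Ring (invIdeal S).ringCon.Quotient)

/-- The canonical homomorphism `σ_S : A → A⟨S⁻¹⟩`. -/
noncomputable def UnivLoc.of : A →+* UnivLoc S :=
  ((invIdeal S).ringCon.mk').comp (FreeExt.C A S)

end Universal

section Setup

variable {R : Type u} [Ring R] (S : Submonoid R) (h : IsOre S)

/-- `R̄ = R/𝔞` with `𝔞 = ass(S)`. -/
abbrev Rbar : Type u := R ⧸ ass S h

/-- The projection `π : R → R̄`. -/
abbrev piBar : R →+* Rbar S h := Ideal.Quotient.mk (ass S h)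

/-- `S̄ = π(S)`. -/
abbrev Sbar : Submonoid (Rbar S h) := S.map (piBar S h)

/-- `R̃ = R̄/𝔫_{R̄}`. -/
abbrev Rtil : Type u := Rbar S h ⧸ primeRadical (Rbar S h)

/-- The projection `π̃ : R̄ → R̃`. -/
abbrev piTil : Rbar S h →+* Rtil S h := Ideal.Quotient.mk (primeRadical (Rbar S h))

/-- The image of `S̄` in `R̃`. -/
abbrev Stil : Submonoid (Rtil S h) := (Sbar S h).map (piTil S h)

/-- The image `𝔭̄` of an ideal `𝔭` in `R̄`. -/
abbrev idBar (p : Ideal R) : Ideal (Rbar S h) := p.map (piBar S h)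

/-- The image of `𝔭̄` in `R̃`. -/
abbrev idTil (p : Ideal R) : Ideal (Rtil S h) := (idBar S h p).map (piTil S h)

/-- The image `π_𝔭(S)` of `S` in `R/𝔭`. -/
abbrev Sres (p : Ideal R) [p.IsTwoSided] : Submonoid (R ⧸ p) := S.map (Ideal.Quotient.mk p)

end Setup

end MinPrimesLoc

open MinPrimesLoc

/-! The crux is `IsNormalElt.notMem_minPrimes`: if a ring has finitely many minimal primes, a
regular normal element `x` lies in none of them. Such an `x` defines an automorphism `φ` by `x a =
φ(a) x`. It permutes the finite set of minimal primes, so some `φⁿ` with `n > 0` fixes a given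
minimal prime `P`. Then the elements `y xⁿᵏ` with `y ∉ P` form an m-system without zero, and a prime
`Q` that avoids it lies inside `P`. Minimality gives `Q = P`, hence `xⁿ ∉ P`.

This applies to `R̄`, where the images of `S` are normal and regular. A normal element outside a
prime is regular modulo it, so every `𝔭̄`, and hence their intersection `𝔫_{R̄}`, is saturated on
both sides with respect to `S̄`. Saturation makes membership of a fraction in a localized ideal
depend only on its numerator. It follows that localized primes are prime and pairwise incomparable,
and that their intersection is the localized radical, with no need for common denominators.

Finitely many incomparable primes whose intersection lies in every prime are all the minimal primes
(`bijOn_minPrimes`). Over `R̃` the intersection is zero. Over `R̄` it is `S̄⁻¹𝔫_{R̄}`, which lies in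
every prime once it is nilpotent. The diagram comes from kernels of induced maps (`Loc.exists_map`),
and `R⟨S⁻¹⟩` is compared with `S̄⁻¹R̄` by universal properties. -/

namespace MinPrimesLoc

/-! ### Prime ideals and minimal primes in noncommutative rings. -/

section PrimeIdeals

variable {A : Type*} [Ring A] {B : Type*} [Ring B]

theorem IsPrimeIdeal.mul_mem_left_right {P : Ideal A} (hP : IsPrimeIdeal P) {x : A} (hx : x ∈ P)
    (a b : A) : a * x * b ∈ P :=
  have := hP.twoSided
  Ideal.mul_mem_right b P (P.mul_mem_left a hx)

theorem IsPrimeIdeal.one_notMem {P : Ideal A} (hP : IsPrimeIdeal P) : (1 : A) ∉ P :=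
  fun h1 => hP.ne_top (P.eq_top_of_isUnit_mem h1 isUnit_one)

theorem IsPrimeIdeal.exists_mul_mul_notMem {P : Ideal A} (hP : IsPrimeIdeal P) {x y : A}
    (hx : x ∉ P) (hy : y ∉ P) : ∃ r, x * r * y ∉ P := by
  by_contra! h
  exact (hP.mem_or_mem x y h).elim hx hy

/-- The intersection of a nonempty chain of prime ideals is prime. -/
theorem isPrimeIdeal_sInf {c : Set (Ideal A)} (hc : IsChain (· ≤ ·) c) (hne : c.Nonempty)
    (h : ∀ P ∈ c, IsPrimeIdeal P) : IsPrimeIdeal (sInf c) where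
  twoSided := ⟨fun {a} b ha => by
    rw [Submodule.mem_sInf] at ha ⊢
    intro P hP
    simpa using (h P hP).mul_mem_left_right (ha P hP) 1 b⟩
  ne_top := by
    obtain ⟨P, hP⟩ := hne
    exact fun htop => (h P hP).ne_top (top_le_iff.1 (htop ▸ sInf_le hP))
  mem_or_mem x y hxy := by
    simp only [Submodule.mem_sInf] at hxy ⊢
    by_contra! hcon
    obtain ⟨⟨P, hP, hxP⟩, Q, hQ, hyQ⟩ := hcon
    rcases hc.total hP hQ with hPQ | hQP
    · exact ((h P hP).mem_or_mem x y fun r => hxy r P hP).elim hxP fun hy => hyQ (hPQ hy)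
    · exact ((h Q hQ).mem_or_mem x y fun r => hxy r Q hQ).elim (fun hx => hxP (hQP hx)) hyQ

theorem exists_minPrimesOver_le {I P : Ideal A} (hP : IsPrimeIdeal P) (hI : I ≤ P) :
    ∃ Q ∈ minPrimesOver I, Q ≤ P := by
  -- Zorn in the order dual, where the intersection of a chain is its upper bound.
  obtain ⟨Q, hQP, hQ⟩ := zorn_le_nonempty₀
    {Q : (Ideal A)ᵒᵈ | IsPrimeIdeal (OrderDual.ofDual Q) ∧ I ≤ OrderDual.ofDual Q} (by
      intro c hc hchain y hy
      let c' : Set (Ideal A) := OrderDual.toDual ⁻¹' c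
      refine ⟨OrderDual.toDual (sInf c'), ⟨isPrimeIdeal_sInf (c := c') hchain.symm ⟨y, hy⟩
        fun Q hQ => (hc hQ).1, ?_⟩, fun z hz => ?_⟩
      · exact le_sInf (s := c') fun Q hQ => (hc hQ).2
      · exact sInf_le (s := c') hz)
    (OrderDual.toDual P) ⟨hP, hI⟩
  exact ⟨OrderDual.ofDual Q, ⟨hQ.1, fun J hJ hJQ => hQ.2 (y := OrderDual.toDual J) hJ hJQ⟩, hQP⟩

theorem minPrimes_eq_minPrimesOver_bot : minPrimes A = minPrimesOver (⊥ : Ideal A) := by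
  simp [minPrimes, minPrimesOver]

theorem minPrimes.isPrimeIdeal {P : Ideal A} (hP : P ∈ minPrimes A) : IsPrimeIdeal P :=
  Minimal.prop hP

theorem minPrimesOver.minimal {I P : Ideal A} (hP : P ∈ minPrimesOver I) :
    Minimal (fun Q : Ideal A => IsPrimeIdeal Q ∧ I ≤ Q) P :=
  hP

theorem minPrimesOver.isPrimeIdeal {I P : Ideal A} (hP : P ∈ minPrimesOver I) : IsPrimeIdeal P :=
  (minPrimesOver.minimal hP).prop.1

theorem minPrimesOver.le {I P : Ideal A} (hP : P ∈ minPrimesOver I) : I ≤ P :=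
  (minPrimesOver.minimal hP).prop.2

theorem primeRadical_le {P : Ideal A} (hP : IsPrimeIdeal P) : primeRadical A ≤ P :=
  sInf_le hP

/-- An ideal maximal among those disjoint from an m-system is prime. -/
theorem exists_isPrimeIdeal_disjoint {M : Set A} (hne : M.Nonempty) (h0 : (0 : A) ∉ M)
    (hM : ∀ x ∈ M, ∀ y ∈ M, ∃ r, x * r * y ∈ M) :
    ∃ P : Ideal A, IsPrimeIdeal P ∧ ∀ x ∈ P, x ∉ M := by
  obtain ⟨P, -, hP⟩ := zorn_le_nonempty₀
    {P : Ideal A | P.IsTwoSided ∧ ∀ x ∈ P, x ∉ M} (by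
      intro c hc hchain J hJ
      have hmem : ∀ z, z ∈ sSup c ↔ ∃ y ∈ c, z ∈ y := fun z =>
        Submodule.mem_sSup_of_directed ⟨J, hJ⟩ hchain.directedOn
      refine ⟨sSup c, ⟨⟨fun {a} b ha => ?_⟩, fun x hx => ?_⟩, fun z hz => le_sSup hz⟩
      · obtain ⟨K, hK, haK⟩ := (hmem a).1 ha
        have := (hc hK).1
        exact (hmem _).2 ⟨K, hK, Ideal.mul_mem_right b K haK⟩
      · obtain ⟨K, hK, hxK⟩ := (hmem x).1 hx
        exact (hc hK).2 x hxK)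
    ⊥ ⟨inferInstance, by rintro x hx; rwa [(Submodule.mem_bot A).1 hx]⟩
  have hmax : ∀ J : Ideal A, J.IsTwoSided → P ≤ J → ∀ x ∈ J, x ∉ P → ∃ m ∈ J, m ∈ M := by
    intro J hJ hPJ x hx hxP
    by_contra! hcon
    exact hxP (hP.2 ⟨hJ, hcon⟩ hPJ hx)
  have := hP.1.1
  refine ⟨P, ⟨hP.1.1, ?_, ?_⟩, hP.1.2⟩
  · rintro rfl
    obtain ⟨m, hm⟩ := hne
    exact hP.1.2 m trivial hm
  · intro x y hxy
    by_contra! hcon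
    -- `J` contains `P` and `x`, so it meets the m-system in some `m`. Then `K` below contains `P`
    -- and `y`, so it meets it in some `k`, and a product `m r k` lies both in `P` and in the
    -- m-system.
    let J : Ideal A :=
      { carrier := {z | ∀ r, z * r * y ∈ P}
        add_mem' := fun {a b} ha hb r => by
          rw [add_mul, add_mul]; exact P.add_mem (ha r) (hb r)
        zero_mem' := fun r => by simp
        smul_mem' := fun c z hz r => by
          simpa [mul_assoc] using P.mul_mem_left c (hz r) }
    obtain ⟨m, hmJ, hmM⟩ := hmax J ⟨fun {a} b ha r => by simpa [mul_assoc] using ha (b * r)⟩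
      (fun z hz r => Ideal.mul_mem_right y P (Ideal.mul_mem_right r P hz)) x hxy hcon.1
    let K : Ideal A :=
      { carrier := {z | ∀ r, m * r * z ∈ P}
        add_mem' := fun {a b} ha hb r => by
          rw [mul_add]; exact P.add_mem (ha r) (hb r)
        zero_mem' := fun r => by simp
        smul_mem' := fun c z hz r => by
          simpa [mul_assoc] using hz (r * c) }
    obtain ⟨k, hkK, hkM⟩ := hmax K
      ⟨fun {a} b ha r => by simpa [mul_assoc] using Ideal.mul_mem_right b P (ha r)⟩
      (fun z hz r => P.mul_mem_left _ hz) y hmJ hcon.2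
    obtain ⟨r, hr⟩ := hM m hmM k hkM
    exact hP.1.2 _ (hkK r) hr

theorem IsPrimeIdeal.comap {f : A →+* B} (hf : Function.Surjective f) {P : Ideal B}
    (hP : IsPrimeIdeal P) : IsPrimeIdeal (P.comap f) where
  twoSided := ⟨fun {a} b ha => by
    have := hP.twoSided
    simpa [Ideal.mem_comap] using Ideal.mul_mem_right (f b) P ha⟩
  ne_top := fun h => hP.one_notMem (by simpa using (Ideal.eq_top_iff_one _).1 h)
  mem_or_mem x y hxy := hP.mem_or_mem (f x) (f y) fun r => by
    obtain ⟨r, rfl⟩ := hf r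
    simpa using hxy r

theorem mem_map_iff_of_ker_le {f : A →+* B} (hf : Function.Surjective f) {I : Ideal A}
    (hI : RingHom.ker f ≤ I) {a : A} : f a ∈ I.map f ↔ a ∈ I := by
  refine ⟨fun h => ?_, Ideal.mem_map_of_mem f⟩
  obtain ⟨b, hb, hab⟩ := (Ideal.mem_map_iff_of_surjective f hf).1 h
  have : a - b ∈ I := hI (by simp [RingHom.mem_ker, hab])
  simpa using I.add_mem this hb

theorem comap_map_of_ker_le {f : A →+* B} (hf : Function.Surjective f) {I : Ideal A}
    (hI : RingHom.ker f ≤ I) : (I.map f).comap f = I :=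
  Ideal.ext fun _ => mem_map_iff_of_ker_le hf hI

theorem IsPrimeIdeal.map {f : A →+* B} (hf : Function.Surjective f) {P : Ideal A}
    (hP : IsPrimeIdeal P) (hker : RingHom.ker f ≤ P) : IsPrimeIdeal (P.map f) where
  twoSided := ⟨fun {a} b ha => by
    obtain ⟨a, rfl⟩ := hf a
    obtain ⟨b, rfl⟩ := hf b
    rw [mem_map_iff_of_ker_le hf hker] at ha
    rw [← map_mul, mem_map_iff_of_ker_le hf hker]
    simpa using hP.mul_mem_left_right ha 1 b⟩
  ne_top := fun h => hP.one_notMem (by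
    rw [← mem_map_iff_of_ker_le hf hker, h]; trivial)
  mem_or_mem x y hxy := by
    obtain ⟨x, rfl⟩ := hf x
    obtain ⟨y, rfl⟩ := hf y
    simp only [mem_map_iff_of_ker_le hf hker]
    exact hP.mem_or_mem x y fun r => by
      simpa only [← map_mul, mem_map_iff_of_ker_le hf hker] using hxy (f r)

theorem map_mem_minPrimes {f : A →+* B} (hf : Function.Surjective f) {P : Ideal A}
    (hP : P ∈ minPrimesOver (RingHom.ker f)) : P.map f ∈ minPrimes B := by
  refine ⟨(minPrimesOver.isPrimeIdeal hP).map hf (minPrimesOver.le hP), fun Q hQ hQP => ?_⟩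
  rw [Ideal.map_le_iff_le_comap]
  refine (minPrimesOver.minimal hP).le_of_le ⟨IsPrimeIdeal.comap hf hQ, fun a ha => ?_⟩ fun a ha => ?_
  · rw [Ideal.mem_comap, RingHom.mem_ker.1 ha]
    exact Q.zero_mem
  · exact (mem_map_iff_of_ker_le hf (minPrimesOver.le hP)).1 (hQP ha)

theorem comap_mem_minPrimesOver {f : A →+* B} (hf : Function.Surjective f) {P : Ideal B}
    (hP : P ∈ minPrimes B) : P.comap f ∈ minPrimesOver (RingHom.ker f) := by
  refine ⟨⟨(minPrimes.isPrimeIdeal hP).comap hf, fun a ha => ?_⟩, fun Q hQ hQP => ?_⟩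
  · rw [Ideal.mem_comap, RingHom.mem_ker.1 ha]
    exact P.zero_mem
  · have := Minimal.le_of_le hP (hQ.1.map hf hQ.2) (Ideal.map_le_iff_le_comap.2 hQP)
    exact (Ideal.comap_mono this).trans (comap_map_of_ker_le hf hQ.2).le

theorem finite_minPrimes_of_surjective {f : A →+* B} (hf : Function.Surjective f)
    (hfin : (minPrimesOver (RingHom.ker f)).Finite) : (minPrimes B).Finite :=
  Set.Finite.of_injOn (f := Ideal.comap f) (fun P (hP : P ∈ minPrimes B) => comap_mem_minPrimesOver hf hP)
    (Ideal.comap_injective_of_surjective f hf).injOn hfin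

theorem mem_primeRadical_iff {a : A} : a ∈ primeRadical A ↔ ∀ P ∈ minPrimes A, a ∈ P := by
  refine ⟨fun h P hP => primeRadical_le (minPrimes.isPrimeIdeal hP) h, fun h => ?_⟩
  refine Submodule.mem_sInf.2 fun P hP => ?_
  obtain ⟨Q, hQ, hQP⟩ := exists_minPrimesOver_le (show IsPrimeIdeal P from hP) bot_le
  exact hQP (h Q (by rwa [minPrimes_eq_minPrimesOver_bot]))

/-- A prime ideal that contains a finite intersection of two-sided ideals contains one of them. -/
theorem IsPrimeIdeal.exists_le_of_finite {ι : Type*} {s : Set ι} (hs : s.Finite) (F : ι → Ideal A)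
    (hF : ∀ i ∈ s, (F i).IsTwoSided) {Q : Ideal A} (hQ : IsPrimeIdeal Q)
    (h : ∀ a, (∀ i ∈ s, a ∈ F i) → a ∈ Q) : ∃ i ∈ s, F i ≤ Q := by
  by_contra! hcon
  -- Such an element is built one ideal at a time: primeness inserts an `r` with `a r b ∉ Q`, and
  -- two-sidedness keeps `a r b` in all the ideals treated so far.
  suffices ∃ a, (∀ i ∈ s, a ∈ F i) ∧ a ∉ Q by
    obtain ⟨a, ha, haQ⟩ := this
    exact haQ (h a ha)
  clear h
  induction s, hs using Set.Finite.induction_on with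
  | empty => exact ⟨1, by simp, hQ.one_notMem⟩
  | @insert i s _ _ ih =>
    obtain ⟨a, ha, haQ⟩ := ih (fun j hj => hF j (Set.mem_insert_of_mem _ hj))
      (fun j hj => hcon j (Set.mem_insert_of_mem _ hj))
    obtain ⟨b, hb, hbQ⟩ := SetLike.not_le_iff_exists.1 (hcon i (Set.mem_insert _ _))
    obtain ⟨r, hr⟩ := hQ.exists_mul_mul_notMem haQ hbQ
    refine ⟨a * r * b, fun j hj => ?_, hr⟩
    rcases hj with rfl | hj
    · exact (F j).mul_mem_left _ hb
    · have := hF j (Set.mem_insert_of_mem _ hj)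
      exact Ideal.mul_mem_right b _ (Ideal.mul_mem_right r _ (ha j hj))

/-- Finitely many pairwise incomparable primes whose intersection lies in every prime are
exactly the minimal primes. -/
theorem bijOn_minPrimes {ι : Type*} {s : Set ι} (hs : s.Finite) (F : ι → Ideal A)
    (hF : ∀ i ∈ s, IsPrimeIdeal (F i)) (hanti : ∀ i ∈ s, ∀ j ∈ s, F i ≤ F j → i = j)
    (h : ∀ Q : Ideal A, IsPrimeIdeal Q → ∀ a, (∀ i ∈ s, a ∈ F i) → a ∈ Q) :
    Set.BijOn F s (minPrimes A) := by
  have key : ∀ Q : Ideal A, IsPrimeIdeal Q → ∃ i ∈ s, F i ≤ Q := fun Q hQ =>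
    hQ.exists_le_of_finite hs F (fun i hi => (hF i hi).twoSided) (h Q hQ)
  refine ⟨fun i hi => ⟨hF i hi, fun Q hQ hQi => ?_⟩, fun i hi j hj hij => hanti i hi j hj hij.le,
    fun Q hQ => ?_⟩
  · obtain ⟨j, hj, hjQ⟩ := key Q hQ
    obtain rfl := hanti j hj i hi (hjQ.trans hQi)
    exact hjQ
  · obtain ⟨i, hi, hiQ⟩ := key Q (minPrimes.isPrimeIdeal hQ)
    exact ⟨i, hi, le_antisymm hiQ (Minimal.le_of_le hQ (hF i hi) hiQ)⟩

/-- A nilpotent left ideal is contained in every prime ideal. -/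
theorem IsNilpotentIdeal.le_isPrimeIdeal {N : Ideal A} (hN : IsNilpotentIdeal N) {Q : Ideal A}
    (hQ : IsPrimeIdeal Q) : N ≤ Q := by
  intro x hx
  by_contra hxQ
  -- Each new factor is `r * x`: primeness supplies `r`, and the left ideal `N` absorbs it.
  have key : ∀ k : ℕ, ∃ l : List A, l.length = k ∧ (∀ y ∈ l, y ∈ N) ∧ l.prod ∉ Q := by
    intro k
    induction k with
    | zero => exact ⟨[], rfl, by simp, by simpa using hQ.one_notMem⟩
    | succ k ih =>
      obtain ⟨l, hl, hlN, hlQ⟩ := ih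
      obtain ⟨r, hr⟩ := hQ.exists_mul_mul_notMem hlQ hxQ
      refine ⟨l ++ [r * x], by simp [hl], fun y hy => ?_, by simpa [mul_assoc] using hr⟩
      rcases List.mem_append.1 hy with hy | hy
      · exact hlN y hy
      · rw [List.mem_singleton.1 hy]
        exact N.mul_mem_left r hx
  obtain ⟨m, hm⟩ := hN
  obtain ⟨l, hl, hlN, hlQ⟩ := key m
  exact hlQ (hm l hl hlN ▸ Q.zero_mem)

theorem bijOn_minPrimes_comap (e : A ≃+* B) :
    Set.BijOn (fun P : Ideal B => P.comap e) (minPrimes B) (minPrimes A) := by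
  have hker : minPrimesOver (RingHom.ker (e : A →+* B)) = minPrimes A := by
    rw [(RingHom.injective_iff_ker_eq_bot (e : A →+* B)).1 e.injective,
      minPrimes_eq_minPrimesOver_bot]
  have hs : Function.Surjective (e : A →+* B) := e.surjective
  refine ⟨fun P hP => hker ▸ comap_mem_minPrimesOver (f := (e : A →+* B)) hs hP,
    (Ideal.comap_injective_of_surjective (e : A →+* B) hs).injOn, fun Q hQ => ?_⟩
  rw [← hker] at hQ
  exact ⟨_, map_mem_minPrimes hs hQ, comap_map_of_ker_le hs (minPrimesOver.le hQ)⟩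

end PrimeIdeals

/-! ### Regular normal elements avoid minimal primes. -/

section NormalElements

variable {A : Type*} [Ring A] {B : Type*} [Ring B]

theorem IsNormalElt.exists_right {x : A} (hx : IsNormalElt x) (a : A) : ∃ b, a * x = x * b :=
  (Set.ext_iff.1 hx (a * x)).1 ⟨a, rfl⟩

theorem IsNormalElt.exists_left {x : A} (hx : IsNormalElt x) (a : A) : ∃ b, x * a = b * x :=
  (Set.ext_iff.1 hx (x * a)).2 ⟨a, rfl⟩

theorem IsNormalElt.map {f : A →+* B} (hf : Function.Surjective f) {x : A} (hx : IsNormalElt x) :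
    IsNormalElt (f x) := by
  refine Set.ext fun y => ⟨?_, ?_⟩
  · rintro ⟨r, rfl⟩
    obtain ⟨r, rfl⟩ := hf r
    obtain ⟨b, hb⟩ := hx.exists_right r
    exact ⟨f b, by rw [← map_mul, hb, map_mul]⟩
  · rintro ⟨r, rfl⟩
    obtain ⟨r, rfl⟩ := hf r
    obtain ⟨b, hb⟩ := hx.exists_left r
    exact ⟨f b, by rw [← map_mul, hb, map_mul]⟩

/-- A regular normal element induces a ring automorphism. -/
theorem IsNormalElt.exists_ringEquiv {x : A} (hx : IsNormalElt x) (hl : ∀ a, x * a = 0 → a = 0)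
    (hr : ∀ a, a * x = 0 → a = 0) : ∃ φ : A ≃+* A, ∀ a, x * a = φ a * x := by
  choose f hf using hx.exists_left
  -- Right cancellation of `x` makes the chosen `f a` unique, so each ring law for `f` may be
  -- checked after multiplying by `x`.
  have hr' : ∀ a b, a * x = b * x → a = b := fun a b hab =>
    sub_eq_zero.1 (hr _ (by rw [sub_mul, hab, sub_self]))
  let F : A →+* A :=
    { toFun := f
      map_one' := hr' _ _ (by rw [← hf, mul_one, one_mul])
      map_mul' := fun a b => hr' _ _ (by
        rw [← hf, ← mul_assoc, hf a, mul_assoc, hf b, mul_assoc])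
      map_zero' := hr' _ _ (by rw [← hf, mul_zero, zero_mul])
      map_add' := fun a b => hr' _ _ (by rw [← hf, mul_add, hf a, hf b, add_mul]) }
  have hinj : Function.Injective F := by
    refine (injective_iff_map_eq_zero F).2 fun a ha => hl a ?_
    rw [hf a, show f a = 0 from ha, zero_mul]
  have hsurj : Function.Surjective F := fun b => by
    obtain ⟨a, ha⟩ := hx.exists_right b
    exact ⟨a, hr' _ _ (by rw [ha, hf a]; rfl)⟩
  exact ⟨RingEquiv.ofBijective F ⟨hinj, hsurj⟩, hf⟩

/-- In a ring with finitely many minimal primes, a regular normal element lies in no minimal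
prime. -/
theorem IsNormalElt.notMem_minPrimes (hfin : (minPrimes A).Finite) {x : A} (hx : IsNormalElt x)
    (hl : ∀ a, x * a = 0 → a = 0) (hr : ∀ a, a * x = 0 → a = 0) {P : Ideal A}
    (hP : P ∈ minPrimes A) : x ∉ P := by
  intro hxP
  obtain ⟨φ, hφ⟩ := hx.exists_ringEquiv hl hr
  have hpp := minPrimes.isPrimeIdeal hP
  -- Every point is periodic under an injective self-map of a finite set.
  obtain ⟨n, hn0, hn⟩ : ∃ n > 0, ∀ a, (φ^[n]) a ∈ P ↔ a ∈ P := by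
    have := hfin.to_subtype
    have hb := bijOn_minPrimes_comap φ
    let g : minPrimes A → minPrimes A := fun Q => ⟨(Q : Ideal A).comap φ, hb.mapsTo Q.2⟩
    have hg : Function.Injective g := fun Q Q' h =>
      Subtype.ext (hb.injOn Q.2 Q'.2 (congrArg Subtype.val h))
    obtain ⟨n, hn0, hn⟩ := hg.mem_periodicPts ⟨P, hP⟩
    refine ⟨n, hn0, fun a => ?_⟩
    have key : ∀ k (Q : minPrimes A) a, a ∈ ((g^[k]) Q : Ideal A) ↔ (φ^[k]) a ∈ (Q : Ideal A) := by
      intro k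
      induction k with
      | zero => simp
      | succ k ih =>
        intro Q a
        rw [Function.iterate_succ_apply, ih, Function.iterate_succ_apply']
        rfl
    rw [← key n ⟨P, hP⟩ a, hn.eq]
  have hpow : ∀ k a, x ^ k * a = (φ^[k]) a * x ^ k := by
    intro k
    induction k with
    | zero => simp
    | succ k ih =>
      intro a
      rw [pow_succ, mul_assoc, hφ, ← mul_assoc, ih, mul_assoc, Function.iterate_succ_apply]
  have hmem : ∀ k a, (φ^[n * k]) a ∈ P ↔ a ∈ P := by
    intro k
    induction k with
    | zero => simp
    | succ k ih =>
      intro a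
      rw [mul_add, mul_one, Function.iterate_add_apply, ih, hn]
  have hr' : ∀ k a, a * x ^ k = 0 → a = 0 := by
    intro k
    induction k with
    | zero => simp
    | succ k ih =>
      intro a ha
      exact ih a (hr _ (by rwa [mul_assoc, ← pow_succ]))
  -- Exponents are multiples of `n` so that moving `z ∉ P` past the power of `x` gives `φ^[n * k]
  -- z`, again outside `P`. The middle factor is chosen as a preimage under `φ^[n * k]` of the one
  -- that primeness supplies.
  obtain ⟨Q, hQ, hQM⟩ := exists_isPrimeIdeal_disjoint (M := {z | ∃ y ∉ P, ∃ k, z = y * x ^ (n * k)})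
    ⟨1, 1, hpp.one_notMem, 0, by simp⟩ (by
      rintro ⟨y, hy, k, hk⟩
      exact hy (hr' _ _ hk.symm ▸ P.zero_mem)) (by
      rintro _ ⟨y, hy, k, rfl⟩ _ ⟨z, hz, j, rfl⟩
      obtain ⟨r, hr⟩ := hpp.exists_mul_mul_notMem hy (mt (hmem k z).1 hz)
      obtain ⟨r, rfl⟩ : ∃ r', (φ^[n * k]) r' = r := (φ.surjective.iterate _) r
      refine ⟨r, _, hr, k + j, ?_⟩
      calc y * x ^ (n * k) * r * (z * x ^ (n * j))
          = y * (x ^ (n * k) * r) * z * x ^ (n * j) := by simp only [mul_assoc]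
        _ = y * (φ^[n * k]) r * (x ^ (n * k) * z) * x ^ (n * j) := by
            rw [hpow]; simp only [mul_assoc]
        _ = _ := by rw [hpow, mul_add, pow_add]; simp only [mul_assoc])
  -- The exponent `k = 0` puts the whole complement of `P` in the m-system, while `y = 1`, `k = 1`
  -- puts `x ^ n` there.
  have hQP : Q ≤ P := fun a ha => by
    by_contra haP
    exact hQM a ha ⟨a, haP, 0, by simp⟩
  have hPQ := Minimal.le_of_le hP hQ hQP
  refine hQM (x ^ (n * 1)) (hPQ ?_) ⟨1, hpp.one_notMem, 1, by simp⟩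
  exact P.pow_mem_of_mem hxP _ (by omega)

/-- By normality `x r a = b x a`, so one product in `P` forces `x A a ⊆ P`, and primeness applies.
-/
theorem IsNormalElt.mem_of_mul_mem_right {x : A} (hx : IsNormalElt x) {P : Ideal A}
    (hP : IsPrimeIdeal P) (hxP : x ∉ P) {a : A} (h : x * a ∈ P) : a ∈ P := by
  refine (hP.mem_or_mem x a fun r => ?_).resolve_left hxP
  obtain ⟨b, hb⟩ := hx.exists_left r
  rw [hb, mul_assoc]
  exact P.mul_mem_left b h

theorem IsNormalElt.mem_of_mul_mem_left {x : A} (hx : IsNormalElt x) {P : Ideal A}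
    (hP : IsPrimeIdeal P) (hxP : x ∉ P) {a : A} (h : a * x ∈ P) : a ∈ P := by
  refine (hP.mem_or_mem a x fun r => ?_).resolve_right hxP
  obtain ⟨b, hb⟩ := hx.exists_right r
  have := hP.twoSided
  rw [mul_assoc, hb, ← mul_assoc]
  exact Ideal.mul_mem_right b P h

theorem isDen_bot_of_isNormalElt {T : Submonoid A} (h0 : (0 : A) ∉ T)
    (hn : ∀ t ∈ T, IsNormalElt t) (hl : ∀ t ∈ T, ∀ a, t * a = 0 → a = 0)
    (hr : ∀ t ∈ T, ∀ a, a * t = 0 → a = 0) : IsDen T ⊥ where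
  left := ⟨⟨h0, fun r s hs => ⟨s, hs, (hn s hs).exists_left r⟩⟩,
    fun r s hs h => ⟨s, hs, by rw [hr s hs r h, mul_zero]⟩⟩
  right := ⟨⟨h0, fun r s hs => ⟨s, hs, (hn s hs).exists_right r⟩⟩,
    fun r s hs h => ⟨s, hs, by rw [hl s hs r h, zero_mul]⟩⟩
  assLeft r := ⟨fun h => ⟨1, T.one_mem, by simpa using h⟩,
    fun ⟨s, hs, h⟩ => by simpa using hl s hs r h⟩
  assRight r := ⟨fun h => ⟨1, T.one_mem, by simpa using h⟩,
    fun ⟨s, hs, h⟩ => by simpa using hr s hs r h⟩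

end NormalElements

/-! ### Left fractions, localized ideals and induced maps. -/

section Localization

variable {A : Type*} [Ring A] {B : Type*} [Ring B] {T : Submonoid A}

theorem Loc.isUnit_of (h : IsLeftDen T) {s : A} (hs : s ∈ T) : IsUnit (Loc.of T h s) :=
  let _ := h.oreSet
  OreLocalization.numerator_isUnit (⟨s, hs⟩ : T)

theorem Loc.of_mul_frac (h : IsLeftDen T) (s : T) (a : A) :
    Loc.of T h s * Loc.frac h s a = Loc.of T h a :=
  let _ := h.oreSet
  OreLocalization.mul_cancel (r := a) (s := s) (t := 1)

/-- Fractions are handled from here on through the equation `s x = a`, with `s` a unit, rather than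
through representatives. -/
theorem Loc.eq_frac_iff (h : IsLeftDen T) (s : T) (a : A) (x : Loc T h) :
    x = Loc.frac h s a ↔ Loc.of T h s * x = Loc.of T h a := by
  rw [← Loc.of_mul_frac h s a]
  exact (Loc.isUnit_of h s.2).mul_right_inj.symm

theorem Loc.exists_of_mul_eq (h : IsLeftDen T) (x : Loc T h) :
    ∃ s ∈ T, ∃ a, Loc.of T h s * x = Loc.of T h a := by
  let _ := h.oreSet
  change OreLocalization T A at x
  induction x with
  | _ a s => exact ⟨s, s.2, a, Loc.of_mul_frac h s a⟩

theorem Loc.exists_mul_eq_zero_of (h : IsLeftDen T) {a : A} (ha : Loc.of T h a = 0) :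
    ∃ s ∈ T, s * a = 0 := by
  let _ := h.oreSet
  have h0 : (OreLocalization.oreDiv a 1 : OreLocalization T A) = OreLocalization.oreDiv 0 1 :=
    ha.trans (map_zero (Loc.of T h)).symm
  obtain ⟨u, v, h1, h2⟩ := OreLocalization.oreDiv_eq_iff.1 h0
  refine ⟨u, u.2, ?_⟩
  simp only [OneMemClass.coe_one, mul_one] at h2
  rw [h2]
  simpa using h1.symm

theorem Loc.of_injective (h : IsDen T ⊥) : Function.Injective (Loc.of T h.left) := by
  refine (injective_iff_map_eq_zero _).2 fun a ha => ?_
  simpa using (h.assLeft a).2 (Loc.exists_mul_eq_zero_of h.left ha)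

theorem Loc.mem_ideal_iff (h : IsLeftDen T) {I : Ideal A} {x : Loc T h} :
    x ∈ Loc.ideal h I ↔ ∃ s ∈ T, ∃ a ∈ I, Loc.of T h s * x = Loc.of T h a :=
  ⟨fun ⟨s, a, ha, hx⟩ => ⟨s, s.2, a, ha, (Loc.eq_frac_iff h s a x).1 hx⟩,
    fun ⟨s, hs, a, ha, hx⟩ => ⟨⟨s, hs⟩, a, ha, (Loc.eq_frac_iff h ⟨s, hs⟩ a x).2 hx⟩⟩

theorem Loc.exists_lift (h : IsLeftDen T) (f : A →+* B) (hf : ∀ t ∈ T, IsUnit (f t)) :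
    ∃ g : Loc T h →+* B, g.comp (Loc.of T h) = f := by
  let _ := h.oreSet
  let u : T →* Bˣ := IsUnit.liftRight (f.toMonoidHom.comp T.subtype) fun t => hf t t.2
  have hu : ∀ s : T, f s = u s := fun _ => rfl
  exact ⟨OreLocalization.universalHom f u hu,
    RingHom.ext fun r => OreLocalization.universalHom_commutes f u hu⟩

theorem Loc.ringHom_ext (h : IsLeftDen T) {f g : Loc T h →+* B}
    (hfg : f.comp (Loc.of T h) = g.comp (Loc.of T h)) : f = g := by
  refine RingHom.ext fun x => ?_
  obtain ⟨s, hs, a, hx⟩ := Loc.exists_of_mul_eq h x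
  have hc : ∀ a, f (Loc.of T h a) = g (Loc.of T h a) := RingHom.congr_fun hfg
  refine ((Loc.isUnit_of h hs).map f).mul_left_cancel ?_
  rw [← map_mul, hx, hc, ← hx, map_mul, hc]

theorem Loc.of_mem_ideal_iff (h : IsLeftDen T) {I : Ideal A} (hI : ∀ t ∈ T, ∀ a, t * a ∈ I → a ∈ I)
    {a : A} : Loc.of T h a ∈ Loc.ideal h I ↔ a ∈ I := by
  refine ⟨fun ha => ?_, fun ha => (Loc.mem_ideal_iff h).2 ⟨1, T.one_mem, a, ha, by simp⟩⟩
  obtain ⟨s, hs, b, hb, hab⟩ := (Loc.mem_ideal_iff h).1 ha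
  obtain ⟨u, hu, h0⟩ := Loc.exists_mul_eq_zero_of h (a := s * a - b) (by
    rw [map_sub, map_mul, hab, sub_self])
  refine hI (u * s) (T.mul_mem hu hs) a ?_
  rw [mul_sub, sub_eq_zero] at h0
  rw [mul_assoc, h0]
  exact I.mul_mem_left u hb

/-- Saturation makes the answer independent of the fraction, so a single one can be tested against
many ideals at once. -/
theorem Loc.mem_ideal_iff_of_mul_eq (h : IsLeftDen T) {I : Ideal A}
    (hI : ∀ t ∈ T, ∀ a, t * a ∈ I → a ∈ I) {x : Loc T h} {s a : A} (hs : s ∈ T)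
    (hx : Loc.of T h s * x = Loc.of T h a) : x ∈ Loc.ideal h I ↔ a ∈ I := by
  refine ⟨fun hxI => (Loc.of_mem_ideal_iff h hI).1 (hx ▸ Ideal.mul_mem_left _ _ hxI), fun ha => ?_⟩
  exact (Loc.mem_ideal_iff h).2 ⟨s, hs, a, ha, hx⟩

theorem Loc.ideal_le_ideal_iff (h : IsLeftDen T) {I J : Ideal A}
    (hJ : ∀ t ∈ T, ∀ a, t * a ∈ J → a ∈ J) : Loc.ideal h I ≤ Loc.ideal h J ↔ I ≤ J := by
  refine ⟨fun hIJ a ha => ?_, fun hIJ x hx => ?_⟩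
  · exact (Loc.of_mem_ideal_iff h hJ).1
      (hIJ ((Loc.mem_ideal_iff h).2 ⟨1, T.one_mem, a, ha, by simp⟩))
  · obtain ⟨s, hs, a, ha, hx⟩ := (Loc.mem_ideal_iff h).1 hx
    exact (Loc.mem_ideal_iff h).2 ⟨s, hs, a, hIJ ha, hx⟩

/-- The Ore condition moves a denominator to the left: `a s⁻¹ b = s'⁻¹ a' b`. The relation `s' a =
a' s` is kept because right saturation then carries membership from `a` to `a'`. -/
theorem Loc.exists_mul_of (h : IsLeftDen T) (x : Loc T h) (a : A) {s : A} (hs : s ∈ T) {b : A}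
    (hx : Loc.of T h s * x = Loc.of T h b) :
    ∃ s' ∈ T, ∃ a', s' * a = a' * s ∧
      Loc.of T h s' * (Loc.of T h a * x) = Loc.of T h (a' * b) := by
  obtain ⟨s', hs', a', h'⟩ := h.ore a s hs
  refine ⟨s', hs', a', h', ?_⟩
  rw [← mul_assoc, ← map_mul, h', map_mul, mul_assoc, hx, map_mul]

theorem Loc.ideal_isTwoSided (h : IsLeftDen T) {I : Ideal A} [I.IsTwoSided]
    (hI : ∀ t ∈ T, ∀ a, a * t ∈ I → a ∈ I) : (Loc.ideal h I).IsTwoSided where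
  mul_mem_of_left {x} y hx := by
    obtain ⟨s, hs, a, ha, hx⟩ := (Loc.mem_ideal_iff h).1 hx
    obtain ⟨t, ht, b, hy⟩ := Loc.exists_of_mul_eq h y
    obtain ⟨t', ht', a', h1, h2⟩ := Loc.exists_mul_of h y a ht hy
    refine (Loc.mem_ideal_iff h).2 ⟨t' * s, T.mul_mem ht' hs, a' * b,
      Ideal.mul_mem_right b I (hI t ht a' (h1 ▸ I.mul_mem_left t' ha)), ?_⟩
    rw [map_mul, mul_assoc, ← mul_assoc (Loc.of T h s), hx, h2]

theorem Loc.isPrimeIdeal_ideal (h : IsLeftDen T) {P : Ideal A} (hP : IsPrimeIdeal P)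
    (hl : ∀ t ∈ T, ∀ a, t * a ∈ P → a ∈ P) (hr : ∀ t ∈ T, ∀ a, a * t ∈ P → a ∈ P) :
    IsPrimeIdeal (Loc.ideal h P) where
  twoSided := have := hP.twoSided; Loc.ideal_isTwoSided h hr
  ne_top htop := hP.ne_top <| (Ideal.eq_top_iff_one _).2 <| (Loc.of_mem_ideal_iff h hl).1 <| by
    rw [htop]; trivial
  mem_or_mem x y hxy := by
    obtain ⟨s, hs, a, hx⟩ := Loc.exists_of_mul_eq h x
    obtain ⟨t, ht, b, hy⟩ := Loc.exists_of_mul_eq h y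
    rw [Loc.mem_ideal_iff_of_mul_eq h hl hs hx, Loc.mem_ideal_iff_of_mul_eq h hl ht hy]
    refine hP.mem_or_mem a b fun c => (Loc.of_mem_ideal_iff h hl).1 ?_
    -- The factor `t` in `c * t` clears the denominator of `y`, leaving `a c b`.
    have := Ideal.mul_mem_left _ (Loc.of T h s) (hxy (Loc.of T h (c * t)))
    rwa [← mul_assoc, ← mul_assoc, hx, map_mul, mul_assoc, mul_assoc, hy, ← map_mul, ← map_mul,
      ← mul_assoc] at this

/-- Pushing all denominators to the left turns a product of `m` fractions into one fraction whose
numerator is a product of `m` elements; right saturation keeps these in `N`. -/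
theorem Loc.isNilpotentIdeal_ideal (h : IsLeftDen T) {N : Ideal A}
    (hr : ∀ t ∈ T, ∀ a, a * t ∈ N → a ∈ N) (hN : IsNilpotentIdeal N) :
    IsNilpotentIdeal (Loc.ideal h N) := by
  have key : ∀ l : List (Loc T h), (∀ x ∈ l, x ∈ Loc.ideal h N) → ∃ s ∈ T, ∃ l' : List A,
      l'.length = l.length ∧ (∀ a ∈ l', a ∈ N) ∧ Loc.of T h s * l.prod = Loc.of T h l'.prod := by
    intro l
    induction l with
    | nil => exact fun _ => ⟨1, T.one_mem, [], rfl, by simp, by simp⟩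
    | cons x l ih =>
      intro hl
      obtain ⟨s, hs, l', hlen, hl', heq⟩ := ih fun y hy => hl y (List.mem_cons_of_mem _ hy)
      obtain ⟨t, ht, a, ha, hx⟩ := (Loc.mem_ideal_iff h).1 (hl x List.mem_cons_self)
      obtain ⟨s', hs', a', h1, h2⟩ := Loc.exists_mul_of h l.prod a hs heq
      refine ⟨s' * t, T.mul_mem hs' ht, a' :: l', by simp [hlen], ?_, ?_⟩
      · rintro b (_ | ⟨_, hb⟩)
        · exact hr s hs a' (h1 ▸ N.mul_mem_left s' ha)
        · exact hl' b hb
      · rw [List.prod_cons, List.prod_cons, map_mul, mul_assoc, ← mul_assoc (Loc.of T h t), hx, h2]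
  obtain ⟨m, hm⟩ := hN
  refine ⟨m, fun l hlm hl => ?_⟩
  obtain ⟨s, hs, l', hlen, hl', heq⟩ := key l hl
  rw [hm l' (hlen.trans hlm) hl', map_zero] at heq
  exact (Loc.isUnit_of h hs).mul_right_eq_zero.1 heq

/-- A surjection that carries `T` onto `T'` extends to a surjection of the localizations, with
kernel the localization of its kernel. -/
theorem Loc.exists_map {T' : Submonoid B} (h : IsLeftDen T) (h' : IsDen T' ⊥) (f : A →+* B)
    (hf : Function.Surjective f) (hT : T.map f = T') :
    ∃ g : Loc T h →+* Loc T' h'.left, g.comp (Loc.of T h) = (Loc.of T' h'.left).comp f ∧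
      Function.Surjective g ∧ RingHom.ker g = Loc.ideal h (RingHom.ker f) := by
  subst hT
  obtain ⟨g, hg⟩ := Loc.exists_lift h ((Loc.of _ h'.left).comp f)
    fun t ht => Loc.isUnit_of h'.left (Submonoid.mem_map_of_mem f ht)
  have hg' : ∀ a, g (Loc.of T h a) = Loc.of _ h'.left (f a) := RingHom.congr_fun hg
  refine ⟨g, hg, fun y => ?_, Ideal.ext fun x => ?_⟩
  · obtain ⟨_, ⟨s, hs, rfl⟩, b, hy⟩ := Loc.exists_of_mul_eq h'.left y
    obtain ⟨a, rfl⟩ := hf b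
    refine ⟨Loc.frac h ⟨s, hs⟩ a, (Loc.isUnit_of h'.left
      (Submonoid.mem_map_of_mem f hs)).mul_left_cancel ?_⟩
    have := congrArg g (Loc.of_mul_frac h ⟨s, hs⟩ a)
    rw [map_mul, hg', hg'] at this
    exact this.trans hy.symm
  · obtain ⟨s, hs, a, hx⟩ := Loc.exists_of_mul_eq h x
    constructor
    · intro hgx
      -- The target denominators are regular, so `f a` vanishes as soon as its image in the
      -- localization does.
      refine (Loc.mem_ideal_iff h).2 ⟨s, hs, a, RingHom.mem_ker.2 (Loc.of_injective h' ?_), hx⟩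
      rw [← hg', ← hx, map_mul, RingHom.mem_ker.1 hgx, mul_zero, map_zero]
    · intro hxI
      obtain ⟨s, hs, a, ha, hx⟩ := (Loc.mem_ideal_iff h).1 hxI
      refine RingHom.mem_ker.2 (((Loc.isUnit_of h hs).map g).mul_right_eq_zero.1 ?_)
      rw [← map_mul, hx, hg', RingHom.mem_ker.1 ha, map_zero]

end Localization

/-! ### The universal property of the ring obtained by inverting `S`. -/

section UniversalLocalization

variable {A : Type*} [Ring A] {B : Type*} [Ring B] {S : Submonoid A}

theorem FreeExt.ringHom_ext {X : Type*} {f g : FreeExt A X →+* B}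
    (hC : f.comp (FreeExt.C A X) = g.comp (FreeExt.C A X))
    (hv : ∀ x, f (FreeExt.var x) = g (FreeExt.var x)) : f = g := by
  refine RingQuot.ringQuot_ext _ _ ?_
  have : ((f.comp (RingQuot.mkRingHom (FreeExtRel A X))).toIntAlgHom :
      FreeAlgebra ℤ (A ⊕ X) →ₐ[ℤ] B) =
      (g.comp (RingQuot.mkRingHom (FreeExtRel A X))).toIntAlgHom := by
    refine FreeAlgebra.hom_ext (funext fun z => ?_)
    rcases z with a | x
    · exact RingHom.congr_fun hC a
    · exact hv x
  exact congrArg (fun F : FreeAlgebra ℤ (A ⊕ X) →ₐ[ℤ] B => (F : FreeAlgebra ℤ (A ⊕ X) →+* B)) this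

theorem FreeExt.exists_lift {X : Type*} (f : A →+* B) (v : X → B) :
    ∃ g : FreeExt A X →+* B, g.comp (FreeExt.C A X) = f ∧ ∀ x, g (FreeExt.var x) = v x := by
  let F : FreeAlgebra ℤ (A ⊕ X) →ₐ[ℤ] B := FreeAlgebra.lift ℤ (Sum.elim f v)
  have hF : ∀ z, F (FreeAlgebra.ι ℤ z) = Sum.elim f v z := fun z => FreeAlgebra.lift_ι_apply _ _
  have hrel : ∀ ⦃x y⦄, FreeExtRel A X x y → (F : FreeAlgebra ℤ (A ⊕ X) →+* B) x =
      (F : FreeAlgebra ℤ (A ⊕ X) →+* B) y := by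
    rintro _ _ (⟨a, b⟩ | ⟨a, b⟩ | _) <;> simp [hF]
  refine ⟨RingQuot.lift ⟨(F : FreeAlgebra ℤ (A ⊕ X) →+* B), hrel⟩, RingHom.ext fun a => ?_,
    fun x => ?_⟩
  · exact (RingQuot.lift_mkRingHom_apply _ hrel _).trans (hF _)
  · exact (RingQuot.lift_mkRingHom_apply _ hrel _).trans (hF _)

variable (S) in
/-- The projection of `A⟨x_s | s ∈ S⟩` onto `A⟨S⁻¹⟩`. -/
noncomputable def UnivLoc.mk : FreeExt A S →+* UnivLoc S :=
  (invIdeal S).ringCon.mk'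

theorem UnivLoc.mk_eq_mk {x y : FreeExt A S} (h : x - y ∈ invIdeal S) :
    UnivLoc.mk S x = UnivLoc.mk S y :=
  (RingCon.eq (invIdeal S).ringCon).2 ((TwoSidedIdeal.rel_iff (invIdeal S) _ _).2 h)

variable (S) in
theorem UnivLoc.of_mul_var (s : S) :
    UnivLoc.of S s * UnivLoc.mk S (FreeExt.var s) = 1 := by
  have h := UnivLoc.mk_eq_mk (TwoSidedIdeal.subset_span (Or.inl ⟨s, rfl⟩) :
    FreeExt.C A S s * FreeExt.var s - 1 ∈ invIdeal S)
  rwa [map_mul, map_one] at h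

variable (S) in
theorem UnivLoc.var_mul_of (s : S) :
    UnivLoc.mk S (FreeExt.var s) * UnivLoc.of S s = 1 := by
  have h := UnivLoc.mk_eq_mk (TwoSidedIdeal.subset_span (Or.inr ⟨s, rfl⟩) :
    FreeExt.var s * FreeExt.C A S s - 1 ∈ invIdeal S)
  rwa [map_mul, map_one] at h

theorem UnivLoc.isUnit_of {s : A} (hs : s ∈ S) : IsUnit (UnivLoc.of S s) :=
  ⟨⟨_, _, UnivLoc.of_mul_var S ⟨s, hs⟩, UnivLoc.var_mul_of S ⟨s, hs⟩⟩, rfl⟩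

/-- Inverses are unique, so the images of the indeterminates are forced by those of `S`. -/
theorem UnivLoc.ringHom_ext {f g : UnivLoc S →+* B}
    (hfg : f.comp (UnivLoc.of S) = g.comp (UnivLoc.of S)) : f = g := by
  have key : f.comp (UnivLoc.mk S) = g.comp (UnivLoc.mk S) := by
    refine FreeExt.ringHom_ext hfg fun s => ?_
    have hs : f (UnivLoc.of S s) = g (UnivLoc.of S s) := RingHom.congr_fun hfg (s : A)
    refine left_inv_eq_right_inv (a := f (UnivLoc.of S s)) ?_ ?_
    · rw [RingHom.comp_apply, ← map_mul, UnivLoc.var_mul_of, map_one]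
    · rw [hs, RingHom.comp_apply, ← map_mul, UnivLoc.of_mul_var, map_one]
  refine RingHom.ext fun x => ?_
  obtain ⟨y, rfl⟩ := RingCon.mk'_surjective (invIdeal S).ringCon x
  exact RingHom.congr_fun key y

theorem UnivLoc.exists_lift (f : A →+* B) (hf : ∀ s ∈ S, IsUnit (f s)) :
    ∃ g : UnivLoc S →+* B, g.comp (UnivLoc.of S) = f := by
  obtain ⟨F, hF, hv⟩ := FreeExt.exists_lift f
    (fun s : S => (((hf s s.2).unit⁻¹ : Bˣ) : B))
  have hF' : ∀ a, F (FreeExt.C A S a) = f a := RingHom.congr_fun hF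
  have hle : invIdeal S ≤ TwoSidedIdeal.ker F := by
    refine TwoSidedIdeal.span_le.2 ?_
    rintro _ (⟨s, rfl⟩ | ⟨s, rfl⟩)
    · refine (TwoSidedIdeal.mem_ker F).2 ?_
      rw [map_sub, map_mul, hF', hv, IsUnit.mul_val_inv, map_one, sub_self]
    · refine (TwoSidedIdeal.mem_ker F).2 ?_
      rw [map_sub, map_mul, hF', hv, IsUnit.val_inv_mul, map_one, sub_self]
  have hker : (invIdeal S).ringCon ≤ RingCon.ker F := fun x y hxy => by
    have := (TwoSidedIdeal.mem_ker F).1 (hle ((TwoSidedIdeal.rel_iff (invIdeal S) _ _).1 hxy))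
    rwa [map_sub, sub_eq_zero] at this
  exact ⟨(invIdeal S).ringCon.lift F hker,
    RingHom.ext fun a => (RingCon.lift_mk' hker _).trans (hF' a)⟩

end UniversalLocalization

/-! ### Kernels and quotient isomorphisms. -/

section Kernels

variable {A : Type*} [Ring A] {B : Type*} [Ring B] {C : Type*} [Ring C]

theorem ker_eq_map_ker_comp {f : A →+* B} (hf : Function.Surjective f) (g : B →+* C) :
    RingHom.ker g = (RingHom.ker (g.comp f)).map f := by
  refine Ideal.ext fun b => ?_
  obtain ⟨a, rfl⟩ := hf b
  have hle : RingHom.ker f ≤ RingHom.ker (g.comp f) := fun a ha => by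
    rw [RingHom.mem_ker, RingHom.comp_apply, RingHom.mem_ker.1 ha, map_zero]
  rw [mem_map_iff_of_ker_le hf hle, RingHom.mem_ker, RingHom.mem_ker, RingHom.comp_apply]

theorem map_map_ringHom (T : Submonoid A) (f : A →+* B) (g : B →+* C) :
    (T.map f).map g = T.map (g.comp f) :=
  SetLike.coe_injective (Set.image_image g f T)

theorem exists_quotientEquiv {g : A →+* B} (hg : Function.Surjective g) {I : Ideal A}
    [I.IsTwoSided] (hI : RingHom.ker g = I) :
    ∃ e : (A ⧸ I) ≃+* B, (e : A ⧸ I →+* B).comp (Ideal.Quotient.mk I) = g := by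
  subst hI
  exact ⟨RingHom.quotientKerEquivOfSurjective hg, RingHom.ext fun _ => rfl⟩

end Kernels

/-! ### The rings `R̄`, `R̃`, `R/𝔭` and their localizations. -/

section Setup

variable {R : Type*} [Ring R] {S : Submonoid R} (hS : IsNormallyGenerated S)

theorem piBar_surjective (h : IsOre S) : Function.Surjective (piBar S h) :=
  Ideal.Quotient.mk_surjective

theorem piTil_surjective (h : IsOre S) : Function.Surjective (piTil S h) :=
  Ideal.Quotient.mk_surjective

theorem ker_piBar (h : IsOre S) : RingHom.ker (piBar S h) = ass S h :=
  Ideal.mk_ker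

theorem ker_piTil (h : IsOre S) : RingHom.ker (piTil S h) = primeRadical (Rbar S h) :=
  Ideal.mk_ker

/-- If `s r ∈ 𝔞` then `u s r v = 0` with `u s, v ∈ S`, so already `r ∈ 𝔞`. -/
theorem Sbar_regular_left (h : IsOre S) :
    ∀ t ∈ Sbar S h, ∀ a, t * a = 0 → a = 0 := by
  rintro _ ⟨s, hs, rfl⟩ a ha
  obtain ⟨r, rfl⟩ := piBar_surjective h a
  rw [← map_mul] at ha
  obtain ⟨u, hu, v, hv, h0⟩ := Ideal.Quotient.eq_zero_iff_mem.1 ha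
  exact Ideal.Quotient.eq_zero_iff_mem.2 ⟨u * s, S.mul_mem hu hs, v, hv, by
    rwa [mul_assoc u s r]⟩

theorem Sbar_regular_right (h : IsOre S) :
    ∀ t ∈ Sbar S h, ∀ a, a * t = 0 → a = 0 := by
  rintro _ ⟨s, hs, rfl⟩ a ha
  obtain ⟨r, rfl⟩ := piBar_surjective h a
  rw [← map_mul] at ha
  obtain ⟨u, hu, v, hv, h0⟩ := Ideal.Quotient.eq_zero_iff_mem.1 ha
  exact Ideal.Quotient.eq_zero_iff_mem.2 ⟨u, hu, s * v, S.mul_mem hs hv, by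
    rwa [← mul_assoc, mul_assoc u r s]⟩

theorem zero_notMem_Sbar (h : IsOre S) : (0 : Rbar S h) ∉ Sbar S h := by
  rintro ⟨s, hs, h0⟩
  obtain ⟨u, hu, v, hv, h0⟩ := Ideal.Quotient.eq_zero_iff_mem.1 h0
  exact h.left.zero_notMem (h0 ▸ S.mul_mem (S.mul_mem hu hs) hv)

theorem isNormalElt_Sbar : ∀ t ∈ Sbar S hS.isOre, IsNormalElt t := by
  rintro _ ⟨s, hs, rfl⟩
  exact (hS.isNormalElt s hs).map (piBar_surjective _)

theorem isNormalElt_Stil : ∀ t ∈ Stil S hS.isOre, IsNormalElt t := by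
  rintro _ ⟨s, hs, rfl⟩
  exact (isNormalElt_Sbar hS s hs).map (piTil_surjective _)

theorem isDen_Sbar : IsDen (Sbar S hS.isOre) ⊥ :=
  isDen_bot_of_isNormalElt (zero_notMem_Sbar _) (isNormalElt_Sbar hS) (Sbar_regular_left _)
    (Sbar_regular_right _)

/-- When `s r t = 0`, inverting `s` and `t` kills `r`, so the map to `R⟨S⁻¹⟩` factors through `R̄`.
Both rings then have the same universal property. -/
theorem exists_univLoc_equiv (h : IsOre S) (d : IsDen (Sbar S h) ⊥) :
    ∃ e : UnivLoc S ≃+* Loc (Sbar S h) d.left,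
      (e : UnivLoc S →+* Loc (Sbar S h) d.left).comp (UnivLoc.of S) =
        (Loc.of (Sbar S h) d.left).comp (piBar S h) := by
  obtain ⟨f, hf⟩ := UnivLoc.exists_lift (S := S) ((Loc.of (Sbar S h) d.left).comp (piBar S h))
    fun s hs => Loc.isUnit_of d.left (Submonoid.mem_map_of_mem _ hs)
  let q : Rbar S h →+* UnivLoc S := Ideal.Quotient.lift (ass S h) (UnivLoc.of S) (by
    rintro r ⟨s, hs, t, ht, h0⟩
    have := congrArg (UnivLoc.of S) h0
    rw [map_mul, map_mul, map_zero] at this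
    exact (UnivLoc.isUnit_of hs).mul_right_eq_zero.1
      ((UnivLoc.isUnit_of ht).mul_left_eq_zero.1 this))
  have hq : q.comp (piBar S h) = UnivLoc.of S := RingHom.ext fun _ => rfl
  obtain ⟨g, hg⟩ := Loc.exists_lift d.left q (by
    rintro _ ⟨s, hs, rfl⟩
    exact UnivLoc.isUnit_of hs)
  refine ⟨RingEquiv.ofRingHom f g ?_ ?_, hf⟩
  · have hfq : f.comp q = Loc.of (Sbar S h) d.left := Ideal.Quotient.ringHom_ext (by
      rw [RingHom.comp_assoc]
      exact (congrArg f.comp hq).trans hf)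
    exact Loc.ringHom_ext d.left (by rw [RingHom.comp_assoc, hg, hfq, RingHom.id_comp])
  · refine UnivLoc.ringHom_ext ?_
    rw [RingHom.comp_assoc, hf, ← RingHom.comp_assoc, hg, hq, RingHom.id_comp]

theorem ker_univLoc_of (h : IsOre S) (d : IsDen (Sbar S h) ⊥) :
    RingHom.ker (UnivLoc.of S) = ass S h := by
  obtain ⟨e, he⟩ := exists_univLoc_equiv h d
  refine Ideal.ext fun r => ?_
  have hr : e (UnivLoc.of S r) = Loc.of (Sbar S h) d.left (piBar S h r) := RingHom.congr_fun he r
  rw [RingHom.mem_ker, ← map_eq_zero_iff e e.injective, hr,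
    map_eq_zero_iff _ (Loc.of_injective d), Ideal.Quotient.eq_zero_iff_mem]

theorem finite_minPrimes_Rbar {h : IsOre S} (hfin : (minPrimesOver (ass S h)).Finite) :
    (minPrimes (Rbar S h)).Finite :=
  finite_minPrimes_of_surjective (piBar_surjective h) (by rwa [ker_piBar])

theorem idBar_mem_minPrimes {h : IsOre S} {p : Ideal R} (hp : p ∈ minPrimesOver (ass S h)) :
    idBar S h p ∈ minPrimes (Rbar S h) :=
  map_mem_minPrimes (piBar_surjective h) (by rwa [ker_piBar])

theorem isPrimeIdeal_idBar {h : IsOre S} {p : Ideal R} (hp : p ∈ minPrimesOver (ass S h)) :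
    IsPrimeIdeal (idBar S h p) :=
  minPrimes.isPrimeIdeal (idBar_mem_minPrimes hp)

theorem ker_piTil_le_idBar {h : IsOre S} {p : Ideal R} (hp : p ∈ minPrimesOver (ass S h)) :
    RingHom.ker (piTil S h) ≤ idBar S h p := by
  rw [ker_piTil]
  exact primeRadical_le (isPrimeIdeal_idBar hp)

theorem isPrimeIdeal_idTil {h : IsOre S} {p : Ideal R} (hp : p ∈ minPrimesOver (ass S h)) :
    IsPrimeIdeal (idTil S h p) :=
  (isPrimeIdeal_idBar hp).map (piTil_surjective h) (ker_piTil_le_idBar hp)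

theorem eq_of_idBar_le {h : IsOre S} {p q : Ideal R} (hp : p ∈ minPrimesOver (ass S h))
    (hq : q ∈ minPrimesOver (ass S h)) (hpq : idBar S h p ≤ idBar S h q) : p = q := by
  have hcomap : ∀ {p : Ideal R}, p ∈ minPrimesOver (ass S h) → (idBar S h p).comap (piBar S h) = p :=
    fun hp => comap_map_of_ker_le (piBar_surjective h) (by
      rw [ker_piBar]; exact minPrimesOver.le hp)
  have hle : p ≤ q := by
    rw [← hcomap hp, ← hcomap hq]
    exact Ideal.comap_mono hpq
  exact le_antisymm hle ((minPrimesOver.minimal hq).le_of_le (minPrimesOver.minimal hp).prop hle)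

theorem eq_of_idTil_le {h : IsOre S} {p q : Ideal R} (hp : p ∈ minPrimesOver (ass S h))
    (hq : q ∈ minPrimesOver (ass S h)) (hpq : idTil S h p ≤ idTil S h q) : p = q := by
  refine eq_of_idBar_le hp hq ?_
  rw [← comap_map_of_ker_le (piTil_surjective h) (ker_piTil_le_idBar hp),
    ← comap_map_of_ker_le (piTil_surjective h) (ker_piTil_le_idBar hq)]
  exact Ideal.comap_mono hpq

theorem mem_primeRadical_Rbar_iff {h : IsOre S} {a : Rbar S h} :
    a ∈ primeRadical (Rbar S h) ↔ ∀ p ∈ minPrimesOver (ass S h), a ∈ idBar S h p := by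
  refine ⟨fun ha p hp => primeRadical_le (isPrimeIdeal_idBar hp) ha, fun ha => ?_⟩
  refine mem_primeRadical_iff.2 fun P hP => ?_
  have hP' := comap_mem_minPrimesOver (piBar_surjective h) hP
  rw [ker_piBar] at hP'
  have := ha _ hP'
  rwa [idBar, Ideal.map_comap_of_surjective _ (piBar_surjective h)] at this

theorem eq_zero_of_forall_mem_idTil {h : IsOre S} {a : Rtil S h}
    (ha : ∀ p ∈ minPrimesOver (ass S h), a ∈ idTil S h p) : a = 0 := by
  obtain ⟨b, rfl⟩ := piTil_surjective h a
  refine Ideal.Quotient.eq_zero_iff_mem.2 (mem_primeRadical_Rbar_iff.2 fun p hp => ?_)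
  exact (mem_map_iff_of_ker_le (piTil_surjective h) (ker_piTil_le_idBar hp)).1 (ha p hp)

theorem notMem_minPrimes_of_mem_Sbar (hfin : (minPrimesOver (ass S hS.isOre)).Finite)
    {P : Ideal (Rbar S hS.isOre)} (hP : P ∈ minPrimes (Rbar S hS.isOre)) :
    ∀ t ∈ Sbar S hS.isOre, t ∉ P := fun t ht =>
  (isNormalElt_Sbar hS t ht).notMem_minPrimes (finite_minPrimes_Rbar hfin)
    (Sbar_regular_left _ t ht) (Sbar_regular_right _ t ht) hP

theorem notMem_of_mem_minPrimesOver_ass (hfin : (minPrimesOver (ass S hS.isOre)).Finite)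
    {p : Ideal R} (hp : p ∈ minPrimesOver (ass S hS.isOre)) : ∀ s ∈ S, s ∉ p := fun _ hs hsp =>
  notMem_minPrimes_of_mem_Sbar hS hfin (idBar_mem_minPrimes hp) _
    (Submonoid.mem_map_of_mem (piBar S hS.isOre) hs) (Ideal.mem_map_of_mem _ hsp)

/-! ### Saturation of the minimal primes and its consequences for the localizations. -/

section Saturation

variable (hfin : (minPrimesOver (ass S hS.isOre)).Finite)
include hfin

theorem mem_idBar_of_mul_mem_right {p : Ideal R} (hp : p ∈ minPrimesOver (ass S hS.isOre)) :
    ∀ t ∈ Sbar S hS.isOre, ∀ a, t * a ∈ idBar S hS.isOre p → a ∈ idBar S hS.isOre p :=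
  fun t ht _ => (isNormalElt_Sbar hS t ht).mem_of_mul_mem_right (isPrimeIdeal_idBar hp)
    (notMem_minPrimes_of_mem_Sbar hS hfin (idBar_mem_minPrimes hp) t ht)

theorem mem_idBar_of_mul_mem_left {p : Ideal R} (hp : p ∈ minPrimesOver (ass S hS.isOre)) :
    ∀ t ∈ Sbar S hS.isOre, ∀ a, a * t ∈ idBar S hS.isOre p → a ∈ idBar S hS.isOre p :=
  fun t ht _ => (isNormalElt_Sbar hS t ht).mem_of_mul_mem_left (isPrimeIdeal_idBar hp)
    (notMem_minPrimes_of_mem_Sbar hS hfin (idBar_mem_minPrimes hp) t ht)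

theorem mem_primeRadical_of_mul_mem_right : ∀ t ∈ Sbar S hS.isOre, ∀ a,
    t * a ∈ primeRadical (Rbar S hS.isOre) → a ∈ primeRadical (Rbar S hS.isOre) :=
  fun t ht a ha => mem_primeRadical_Rbar_iff.2 fun p hp =>
    mem_idBar_of_mul_mem_right hS hfin hp t ht a (mem_primeRadical_Rbar_iff.1 ha p hp)

theorem mem_primeRadical_of_mul_mem_left : ∀ t ∈ Sbar S hS.isOre, ∀ a,
    a * t ∈ primeRadical (Rbar S hS.isOre) → a ∈ primeRadical (Rbar S hS.isOre) :=
  fun t ht a ha => mem_primeRadical_Rbar_iff.2 fun p hp =>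
    mem_idBar_of_mul_mem_left hS hfin hp t ht a (mem_primeRadical_Rbar_iff.1 ha p hp)

theorem notMem_idTil_of_mem_Stil {p : Ideal R} (hp : p ∈ minPrimesOver (ass S hS.isOre)) :
    ∀ t ∈ Stil S hS.isOre, t ∉ idTil S hS.isOre p := by
  rintro _ ⟨t, ht, rfl⟩ h
  exact notMem_minPrimes_of_mem_Sbar hS hfin (idBar_mem_minPrimes hp) t ht
    ((mem_map_iff_of_ker_le (piTil_surjective _) (ker_piTil_le_idBar hp)).1 h)

theorem mem_idTil_of_mul_mem_right {p : Ideal R} (hp : p ∈ minPrimesOver (ass S hS.isOre)) :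
    ∀ t ∈ Stil S hS.isOre, ∀ a, t * a ∈ idTil S hS.isOre p → a ∈ idTil S hS.isOre p :=
  fun t ht _ => (isNormalElt_Stil hS t ht).mem_of_mul_mem_right (isPrimeIdeal_idTil hp)
    (notMem_idTil_of_mem_Stil hS hfin hp t ht)

theorem mem_idTil_of_mul_mem_left {p : Ideal R} (hp : p ∈ minPrimesOver (ass S hS.isOre)) :
    ∀ t ∈ Stil S hS.isOre, ∀ a, a * t ∈ idTil S hS.isOre p → a ∈ idTil S hS.isOre p :=
  fun t ht _ => (isNormalElt_Stil hS t ht).mem_of_mul_mem_left (isPrimeIdeal_idTil hp)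
    (notMem_idTil_of_mem_Stil hS hfin hp t ht)

theorem isDen_Stil : IsDen (Stil S hS.isOre) ⊥ := by
  refine isDen_bot_of_isNormalElt ?_ (isNormalElt_Stil hS) ?_ ?_
  · rintro ⟨t, ht, h0⟩
    -- A `t ∈ S̄` in the radical would put `1` there by saturation. But `R̄` is nonzero, so `{1}` is
    -- an m-system without zero and a prime exists.
    have h1 : (1 : Rbar S hS.isOre) ∈ primeRadical (Rbar S hS.isOre) :=
      mem_primeRadical_of_mul_mem_right hS hfin t ht 1
        (by rw [mul_one]; exact Ideal.Quotient.eq_zero_iff_mem.1 h0)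
    obtain ⟨P, hP, -⟩ := exists_isPrimeIdeal_disjoint (A := Rbar S hS.isOre)
      (M := {1}) ⟨1, rfl⟩ (fun h01 => zero_notMem_Sbar hS.isOre
        (Set.mem_singleton_iff.1 h01 ▸ Submonoid.one_mem _)) (by
        rintro _ rfl _ rfl
        exact ⟨1, by simp⟩)
    exact hP.one_notMem (primeRadical_le hP h1)
  · exact fun t ht _ ha => eq_zero_of_forall_mem_idTil fun p hp =>
      mem_idTil_of_mul_mem_right hS hfin hp t ht _ (ha ▸ Submodule.zero_mem _)
  · exact fun t ht _ ha => eq_zero_of_forall_mem_idTil fun p hp =>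
      mem_idTil_of_mul_mem_left hS hfin hp t ht _ (ha ▸ Submodule.zero_mem _)

theorem isDen_Sres {p : Ideal R} [p.IsTwoSided] (hp : p ∈ minPrimesOver (ass S hS.isOre)) :
    IsDen (Sres S p) ⊥ := by
  have hpp := minPrimesOver.isPrimeIdeal hp
  have hnot := notMem_of_mem_minPrimesOver_ass hS hfin hp
  refine isDen_bot_of_isNormalElt ?_ ?_ ?_ ?_
  · rintro ⟨s, hs, h0⟩
    exact hnot s hs (Ideal.Quotient.eq_zero_iff_mem.1 h0)
  · rintro _ ⟨s, hs, rfl⟩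
    exact (hS.isNormalElt s hs).map Ideal.Quotient.mk_surjective
  · rintro _ ⟨s, hs, rfl⟩ a ha
    obtain ⟨a, rfl⟩ := Ideal.Quotient.mk_surjective a
    rw [← map_mul, Ideal.Quotient.eq_zero_iff_mem] at ha
    exact Ideal.Quotient.eq_zero_iff_mem.2
      ((hS.isNormalElt s hs).mem_of_mul_mem_right hpp (hnot s hs) ha)
  · rintro _ ⟨s, hs, rfl⟩ a ha
    obtain ⟨a, rfl⟩ := Ideal.Quotient.mk_surjective a
    rw [← map_mul, Ideal.Quotient.eq_zero_iff_mem] at ha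
    exact Ideal.Quotient.eq_zero_iff_mem.2
      ((hS.isNormalElt s hs).mem_of_mul_mem_left hpp (hnot s hs) ha)

theorem isPrimeIdeal_loc_idBar (d : IsLeftDen (Sbar S hS.isOre)) {p : Ideal R}
    (hp : p ∈ minPrimesOver (ass S hS.isOre)) :
    IsPrimeIdeal (Loc.ideal d (idBar S hS.isOre p)) :=
  Loc.isPrimeIdeal_ideal d (isPrimeIdeal_idBar hp) (mem_idBar_of_mul_mem_right hS hfin hp)
    (mem_idBar_of_mul_mem_left hS hfin hp)

theorem isPrimeIdeal_loc_idTil (d : IsLeftDen (Stil S hS.isOre)) {p : Ideal R}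
    (hp : p ∈ minPrimesOver (ass S hS.isOre)) :
    IsPrimeIdeal (Loc.ideal d (idTil S hS.isOre p)) :=
  Loc.isPrimeIdeal_ideal d (isPrimeIdeal_idTil hp) (mem_idTil_of_mul_mem_right hS hfin hp)
    (mem_idTil_of_mul_mem_left hS hfin hp)

theorem eq_of_loc_idBar_le (d : IsLeftDen (Sbar S hS.isOre)) {p q : Ideal R}
    (hp : p ∈ minPrimesOver (ass S hS.isOre)) (hq : q ∈ minPrimesOver (ass S hS.isOre))
    (hpq : Loc.ideal d (idBar S hS.isOre p) ≤ Loc.ideal d (idBar S hS.isOre q)) : p = q :=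
  eq_of_idBar_le hp hq
    ((Loc.ideal_le_ideal_iff d (mem_idBar_of_mul_mem_right hS hfin hq)).1 hpq)

theorem eq_of_loc_idTil_le (d : IsLeftDen (Stil S hS.isOre)) {p q : Ideal R}
    (hp : p ∈ minPrimesOver (ass S hS.isOre)) (hq : q ∈ minPrimesOver (ass S hS.isOre))
    (hpq : Loc.ideal d (idTil S hS.isOre p) ≤ Loc.ideal d (idTil S hS.isOre q)) : p = q :=
  eq_of_idTil_le hp hq
    ((Loc.ideal_le_ideal_iff d (mem_idTil_of_mul_mem_right hS hfin hq)).1 hpq)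

theorem mem_loc_primeRadical_of_forall (d : IsLeftDen (Sbar S hS.isOre))
    {x : Loc (Sbar S hS.isOre) d}
    (hx : ∀ p ∈ minPrimesOver (ass S hS.isOre), x ∈ Loc.ideal d (idBar S hS.isOre p)) :
    x ∈ Loc.ideal d (primeRadical (Rbar S hS.isOre)) := by
  obtain ⟨s, hs, a, hxa⟩ := Loc.exists_of_mul_eq d x
  exact (Loc.mem_ideal_iff d).2 ⟨s, hs, a, mem_primeRadical_Rbar_iff.2 fun p hp =>
    (Loc.mem_ideal_iff_of_mul_eq d (mem_idBar_of_mul_mem_right hS hfin hp) hs hxa).1 (hx p hp),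
    hxa⟩

theorem eq_zero_of_forall_mem_loc_idTil (d : IsLeftDen (Stil S hS.isOre))
    {x : Loc (Stil S hS.isOre) d}
    (hx : ∀ p ∈ minPrimesOver (ass S hS.isOre), x ∈ Loc.ideal d (idTil S hS.isOre p)) :
    x = 0 := by
  obtain ⟨s, hs, a, hxa⟩ := Loc.exists_of_mul_eq d x
  have ha : a = 0 := eq_zero_of_forall_mem_idTil fun p hp =>
    (Loc.mem_ideal_iff_of_mul_eq d (mem_idTil_of_mul_mem_right hS hfin hp) hs hxa).1 (hx p hp)
  rw [ha, map_zero] at hxa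
  exact (Loc.isUnit_of d hs).mul_right_eq_zero.1 hxa

theorem primeRadical_loc_le (d : IsLeftDen (Sbar S hS.isOre)) :
    primeRadical (Loc (Sbar S hS.isOre) d) ≤ Loc.ideal d (primeRadical (Rbar S hS.isOre)) :=
  fun _ hx => mem_loc_primeRadical_of_forall hS hfin d fun _ hp =>
    primeRadical_le (isPrimeIdeal_loc_idBar hS hfin d hp) hx

theorem bijOn_loc_idTil (d : IsLeftDen (Stil S hS.isOre)) :
    Set.BijOn (fun p : Ideal R => Loc.ideal d (idTil S hS.isOre p))
      (minPrimesOver (ass S hS.isOre)) (minPrimes (Loc (Stil S hS.isOre) d)) :=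
  bijOn_minPrimes hfin _ (fun _ hp => isPrimeIdeal_loc_idTil hS hfin d hp)
    (fun _ hp _ hq => eq_of_loc_idTil_le hS hfin d hp hq)
    fun Q _ _ ha => eq_zero_of_forall_mem_loc_idTil hS hfin d ha ▸ Q.zero_mem

theorem loc_primeRadical_le_of_isNilpotentIdeal (d : IsLeftDen (Sbar S hS.isOre))
    (hN : IsNilpotentIdeal (primeRadical (Rbar S hS.isOre)))
    {Q : Ideal (Loc (Sbar S hS.isOre) d)} (hQ : IsPrimeIdeal Q) :
    Loc.ideal d (primeRadical (Rbar S hS.isOre)) ≤ Q :=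
  (Loc.isNilpotentIdeal_ideal d (mem_primeRadical_of_mul_mem_left hS hfin) hN).le_isPrimeIdeal hQ

theorem bijOn_loc_idBar (d : IsLeftDen (Sbar S hS.isOre))
    (hN : IsNilpotentIdeal (primeRadical (Rbar S hS.isOre))) :
    Set.BijOn (fun p : Ideal R => Loc.ideal d (idBar S hS.isOre p))
      (minPrimesOver (ass S hS.isOre)) (minPrimes (Loc (Sbar S hS.isOre) d)) :=
  bijOn_minPrimes hfin _ (fun _ hp => isPrimeIdeal_loc_idBar hS hfin d hp)
    (fun _ hp _ hq => eq_of_loc_idBar_le hS hfin d hp hq)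
    fun _ hQ _ ha => loc_primeRadical_le_of_isNilpotentIdeal hS hfin d hN hQ
      (mem_loc_primeRadical_of_forall hS hfin d ha)

end Saturation

/-- The projection `R̃ → R/𝔭`, with its kernel and that of its composition with `R̄ → R̃`. -/
theorem exists_piP {h : IsOre S} {p : Ideal R} [p.IsTwoSided]
    (hp : p ∈ minPrimesOver (ass S h)) :
    ∃ f : Rtil S h →+* R ⧸ p, (f.comp (piTil S h)).comp (piBar S h) = Ideal.Quotient.mk p ∧
      Function.Surjective f ∧ RingHom.ker (f.comp (piTil S h)) = idBar S h p ∧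
      RingHom.ker f = idTil S h p := by
  let q : Rbar S h →+* R ⧸ p := Ideal.Quotient.lift (ass S h) (Ideal.Quotient.mk p)
    fun a ha => Ideal.Quotient.eq_zero_iff_mem.2 (minPrimesOver.le hp ha)
  have hq : q.comp (piBar S h) = Ideal.Quotient.mk p := RingHom.ext fun _ => rfl
  have hkq : RingHom.ker q = idBar S h p := by
    rw [ker_eq_map_ker_comp (piBar_surjective h) q, hq, Ideal.mk_ker]
  let f : Rtil S h →+* R ⧸ p := Ideal.Quotient.lift (primeRadical (Rbar S h)) q fun a ha => by
    rw [← RingHom.mem_ker, hkq]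
    exact primeRadical_le (isPrimeIdeal_idBar hp) ha
  have hf : f.comp (piTil S h) = q := RingHom.ext fun _ => rfl
  refine ⟨f, by rw [hf, hq], fun y => ?_, by rw [hf, hkq], ?_⟩
  · obtain ⟨r, rfl⟩ := Ideal.Quotient.mk_surjective y
    exact ⟨piTil S h (piBar S h r), rfl⟩
  · rw [ker_eq_map_ker_comp (piTil_surjective h) f, hf, hkq]

theorem map_Stil_eq_Sres {h : IsOre S} {p : Ideal R} [p.IsTwoSided] {f : Rtil S h →+* R ⧸ p}
    (hf : (f.comp (piTil S h)).comp (piBar S h) = Ideal.Quotient.mk p) :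
    (Stil S h).map f = Sres S p := by
  rw [Sres, ← hf, Stil, Sbar, map_map_ringHom, map_map_ringHom]

/-- By uniqueness `β ∘ α` is the map induced directly by `R̄ → R/𝔭`, whose kernel is already known.
-/
theorem ker_comp_map_loc {h : IsOre S} {p : Ideal R} [p.IsTwoSided]
    (dBar : IsDen (Sbar S h) ⊥) (dTil : IsDen (Stil S h) ⊥) (dRes : IsDen (Sres S p) ⊥)
    {f : Rtil S h →+* R ⧸ p}
    (hf : (f.comp (piTil S h)).comp (piBar S h) = Ideal.Quotient.mk p)
    (hfs : Function.Surjective f) {α : Loc (Sbar S h) dBar.left →+* Loc (Stil S h) dTil.left}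
    {β : Loc (Stil S h) dTil.left →+* Loc (Sres S p) dRes.left}
    (hα : α.comp (Loc.of _ dBar.left) = (Loc.of _ dTil.left).comp (piTil S h))
    (hβ : β.comp (Loc.of _ dTil.left) = (Loc.of _ dRes.left).comp f) :
    RingHom.ker (β.comp α) = Loc.ideal dBar.left (RingHom.ker (f.comp (piTil S h))) := by
  obtain ⟨g, hg, -, hgk⟩ := Loc.exists_map dBar.left dRes (f.comp (piTil S h))
    (hfs.comp (piTil_surjective h)) 
      ((map_map_ringHom _ _ _).symm.trans (map_Stil_eq_Sres hf))
  have : β.comp α = g := Loc.ringHom_ext dBar.left (by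
    rw [hg, RingHom.comp_assoc, hα, ← RingHom.comp_assoc, hβ, RingHom.comp_assoc])
  rw [this, hgk]

end Setup

end MinPrimesLoc

/-! ### Assembly of the four parts and of the diagram. -/

theorem mainTheorem2 {R : Type*} [Ring R] (S : Submonoid R) (hS : IsNormallyGenerated S)
    (hfin : (minPrimesOver (ass S hS.isOre)).Finite) :
    -- `S̄ ∈ Den(R̄, 0)`, `𝔞 = ker(R → R⟨S⁻¹⟩)` and `R⟨S⁻¹⟩ ≃ S̄⁻¹R̄` over `R`
    RingHom.ker (UnivLoc.of S) = ass S hS.isOre ∧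
    ∃ (dBar : IsDen (Sbar S hS.isOre) ⊥)
      (e : UnivLoc S ≃+* Loc (Sbar S hS.isOre) dBar.left),
      (e : UnivLoc S →+* Loc (Sbar S hS.isOre) dBar.left).comp (UnivLoc.of S) =
        (Loc.of (Sbar S hS.isOre) dBar.left).comp (piBar S hS.isOre) ∧
      -- Part 1
      Set.MapsTo (fun p : Ideal R => Loc.ideal dBar.left (idBar S hS.isOre p))
        (minPrimesOver (ass S hS.isOre)) (primeSpec (Loc (Sbar S hS.isOre) dBar.left)) ∧
      Set.InjOn (fun p : Ideal R => Loc.ideal dBar.left (idBar S hS.isOre p))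
        (minPrimesOver (ass S hS.isOre)) ∧
      Set.MapsTo (fun p : Ideal R => (Loc.ideal dBar.left (idBar S hS.isOre p)).comap e)
        (minPrimesOver (ass S hS.isOre)) (primeSpec (UnivLoc S)) ∧
      Set.InjOn (fun p : Ideal R => (Loc.ideal dBar.left (idBar S hS.isOre p)).comap e)
        (minPrimesOver (ass S hS.isOre)) ∧
      primeRadical (Loc (Sbar S hS.isOre) dBar.left) ≤
        Loc.ideal dBar.left (primeRadical (Rbar S hS.isOre)) ∧
      -- Part 2
      ∃ (dTil : IsDen (Stil S hS.isOre) ⊥)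
        (_ : (Loc.ideal dBar.left (primeRadical (Rbar S hS.isOre))).IsTwoSided)
        (α : Loc (Sbar S hS.isOre) dBar.left →+* Loc (Stil S hS.isOre) dTil.left)
        (γ : (Loc (Sbar S hS.isOre) dBar.left ⧸
            Loc.ideal dBar.left (primeRadical (Rbar S hS.isOre))) ≃+*
          Loc (Stil S hS.isOre) dTil.left),
        α.comp (Loc.of (Sbar S hS.isOre) dBar.left) =
          (Loc.of (Stil S hS.isOre) dTil.left).comp (piTil S hS.isOre) ∧
        (γ : _ →+* Loc (Stil S hS.isOre) dTil.left).comp (Ideal.Quotient.mk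
          (Loc.ideal dBar.left (primeRadical (Rbar S hS.isOre)))) = α ∧
        Set.BijOn (fun p : Ideal R => Loc.ideal dTil.left (idTil S hS.isOre p))
          (minPrimesOver (ass S hS.isOre)) (minPrimes (Loc (Stil S hS.isOre) dTil.left)) ∧
        -- Part 3
        (∀ p : minPrimesOver (ass S hS.isOre),
          ∃ (dRes : IsDen (Sres S (p : Ideal R)) ⊥)
            (_ : (Loc.ideal dBar.left (idBar S hS.isOre p)).IsTwoSided)
            (_ : (Loc.ideal dTil.left (idTil S hS.isOre p)).IsTwoSided)
            (piP : Rtil S hS.isOre →+* R ⧸ (p : Ideal R))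
            (β : Loc (Stil S hS.isOre) dTil.left →+* Loc (Sres S (p : Ideal R)) dRes.left)
            (δ : (Loc (Stil S hS.isOre) dTil.left ⧸ Loc.ideal dTil.left (idTil S hS.isOre p)) ≃+*
              Loc (Sres S (p : Ideal R)) dRes.left)
            (ε : (Loc (Sbar S hS.isOre) dBar.left ⧸
                primeRadical (Loc (Sbar S hS.isOre) dBar.left)) →+*
              (Loc (Sbar S hS.isOre) dBar.left ⧸
                Loc.ideal dBar.left (primeRadical (Rbar S hS.isOre))))
            (ζ : (Loc (Sbar S hS.isOre) dBar.left ⧸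
                Loc.ideal dBar.left (primeRadical (Rbar S hS.isOre))) →+*
              (Loc (Stil S hS.isOre) dTil.left ⧸ Loc.ideal dTil.left (idTil S hS.isOre p)))
            (η : (Loc (Sbar S hS.isOre) dBar.left ⧸
                Loc.ideal dBar.left (primeRadical (Rbar S hS.isOre))) →+*
              (Loc (Sbar S hS.isOre) dBar.left ⧸ Loc.ideal dBar.left (idBar S hS.isOre p)))
            (θ : (Loc (Sbar S hS.isOre) dBar.left ⧸ Loc.ideal dBar.left (idBar S hS.isOre p)) ≃+*
              (Loc (Stil S hS.isOre) dTil.left ⧸ Loc.ideal dTil.left (idTil S hS.isOre p))),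
            -- top row
            (piP.comp (piTil S hS.isOre)).comp (piBar S hS.isOre) =
              Ideal.Quotient.mk (p : Ideal R) ∧
            -- square `R̃ → R/𝔭` over `S̃⁻¹R̃ → π_𝔭(S)⁻¹(R/𝔭)`
            β.comp (Loc.of (Stil S hS.isOre) dTil.left) =
              (Loc.of (Sres S (p : Ideal R)) dRes.left).comp piP ∧
            -- triangle through `S̃⁻¹R̃/S̃⁻¹𝔭̃`
            (δ : _ →+* Loc (Sres S (p : Ideal R)) dRes.left).comp
              (Ideal.Quotient.mk (Loc.ideal dTil.left (idTil S hS.isOre p))) = β ∧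
            -- `S̄⁻¹R̄/𝔫 → S̄⁻¹R̄/S̄⁻¹𝔫_{R̄}`
            ε.comp (Ideal.Quotient.mk (primeRadical (Loc (Sbar S hS.isOre) dBar.left))) =
              Ideal.Quotient.mk (Loc.ideal dBar.left (primeRadical (Rbar S hS.isOre))) ∧
            -- triangle `S̄⁻¹R̄/S̄⁻¹𝔫_{R̄} ≃ S̃⁻¹R̃ → S̃⁻¹R̃/S̃⁻¹𝔭̃`
            (Ideal.Quotient.mk (Loc.ideal dTil.left (idTil S hS.isOre p))).comp
              (γ : _ →+* Loc (Stil S hS.isOre) dTil.left) = ζ ∧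
            -- `S̄⁻¹R̄/S̄⁻¹𝔫_{R̄} → S̄⁻¹R̄/S̄⁻¹𝔭̄`
            η.comp (Ideal.Quotient.mk
                (Loc.ideal dBar.left (primeRadical (Rbar S hS.isOre)))) =
              Ideal.Quotient.mk (Loc.ideal dBar.left (idBar S hS.isOre p)) ∧
            -- triangle through `S̄⁻¹R̄/S̄⁻¹𝔭̄ ≃ S̃⁻¹R̃/S̃⁻¹𝔭̃`
            (θ : _ →+* (Loc (Stil S hS.isOre) dTil.left ⧸
              Loc.ideal dTil.left (idTil S hS.isOre p))).comp η = ζ) ∧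
        -- Part 4
        (IsNilpotentIdeal (primeRadical (Rbar S hS.isOre)) →
          Set.BijOn (fun p : Ideal R => Loc.ideal dBar.left (idBar S hS.isOre p))
            (minPrimesOver (ass S hS.isOre)) (minPrimes (Loc (Sbar S hS.isOre) dBar.left)) ∧
          Set.BijOn (fun p : Ideal R => (Loc.ideal dBar.left (idBar S hS.isOre p)).comap e)
            (minPrimesOver (ass S hS.isOre)) (minPrimes (UnivLoc S)) ∧
          Loc.ideal dBar.left (primeRadical (Rbar S hS.isOre)) =
            primeRadical (Loc (Sbar S hS.isOre) dBar.left) ∧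
          ∃ (κ : (Loc (Sbar S hS.isOre) dBar.left ⧸
                Loc.ideal dBar.left (primeRadical (Rbar S hS.isOre))) ≃+*
              (Loc (Sbar S hS.isOre) dBar.left ⧸
                primeRadical (Loc (Sbar S hS.isOre) dBar.left)))
            (μ : (Loc (Sbar S hS.isOre) dBar.left ⧸
                primeRadical (Loc (Sbar S hS.isOre) dBar.left)) ≃+*
              Loc (Stil S hS.isOre) dTil.left),
            (κ : _ →+* (Loc (Sbar S hS.isOre) dBar.left ⧸
                primeRadical (Loc (Sbar S hS.isOre) dBar.left))).comp
              (Ideal.Quotient.mk (Loc.ideal dBar.left (primeRadical (Rbar S hS.isOre)))) =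
                Ideal.Quotient.mk (primeRadical (Loc (Sbar S hS.isOre) dBar.left)) ∧
            (μ : _ →+* Loc (Stil S hS.isOre) dTil.left).comp
              (Ideal.Quotient.mk (primeRadical (Loc (Sbar S hS.isOre) dBar.left))) = α) := by
  have dBar := isDen_Sbar hS
  have dTil := isDen_Stil hS hfin
  obtain ⟨e, he⟩ := exists_univLoc_equiv hS.isOre dBar
  have hker := ker_univLoc_of hS.isOre dBar
  have hprime := fun p hp => isPrimeIdeal_loc_idBar hS hfin dBar.left (p := p) hp
  have hinj : Set.InjOn (fun p : Ideal R => Loc.ideal dBar.left (idBar S hS.isOre p))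
      (minPrimesOver (ass S hS.isOre)) := fun p hp q hq hpq =>
    eq_of_loc_idBar_le hS hfin dBar.left hp hq (le_of_eq hpq)
  have hrad := primeRadical_loc_le hS hfin dBar.left
  have hN : (Loc.ideal dBar.left (primeRadical (Rbar S hS.isOre))).IsTwoSided :=
    Loc.ideal_isTwoSided dBar.left (mem_primeRadical_of_mul_mem_left hS hfin)
  obtain ⟨α, hα, hαs, hαk⟩ := Loc.exists_map dBar.left dTil (piTil S hS.isOre)
    (piTil_surjective _) rfl
  rw [ker_piTil] at hαk
  obtain ⟨γ, hγ⟩ := exists_quotientEquiv hαs hαk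
  refine ⟨hker, dBar, e, he, hprime, hinj,
    fun p hp => IsPrimeIdeal.comap (f := (e : UnivLoc S →+* Loc (Sbar S hS.isOre) dBar.left))
      e.surjective (hprime p hp),
    (Ideal.comap_injective_of_surjective (e : UnivLoc S →+* Loc (Sbar S hS.isOre) dBar.left)
      e.surjective).comp_injOn hinj,
    hrad, dTil, hN, α, γ, hα, hγ, bijOn_loc_idTil hS hfin dTil.left, fun p => ?_, fun hnil => ?_⟩
  · have dRes : IsDen (Sres S (p : Ideal R)) ⊥ := isDen_Sres hS hfin p.2
    have hP := (hprime p p.2).twoSided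
    have hQ := (isPrimeIdeal_loc_idTil hS hfin dTil.left p.2).twoSided
    obtain ⟨piP, hpiP, hpiPs, hpiPk, hpiPk'⟩ := exists_piP p.2
    obtain ⟨β, hβ, hβs, hβk⟩ := Loc.exists_map dTil.left dRes piP hpiPs (map_Stil_eq_Sres hpiP)
    have hβα := ker_comp_map_loc dBar dTil dRes hpiP hpiPs hα hβ
    rw [hpiPk'] at hβk
    rw [hpiPk] at hβα
    obtain ⟨δ, hδ⟩ := exists_quotientEquiv hβs hβk
    obtain ⟨ρ, hρ⟩ := exists_quotientEquiv (g := β.comp α) (hβs.comp hαs) hβα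
    have hle : Loc.ideal dBar.left (primeRadical (Rbar S hS.isOre)) ≤
        Loc.ideal dBar.left (idBar S hS.isOre p) :=
      (Loc.ideal_le_ideal_iff dBar.left (mem_idBar_of_mul_mem_right hS hfin p.2)).2
        (primeRadical_le (isPrimeIdeal_idBar p.2))
    refine ⟨dRes, hP, hQ, piP, β, δ, Ideal.Quotient.factor hrad, _, Ideal.Quotient.factor hle,
      ρ.trans δ.symm, hpiP, hβ, hδ, RingHom.ext fun _ => rfl, rfl, RingHom.ext fun _ => rfl,
      Ideal.Quotient.ringHom_ext (RingHom.ext fun x => ?_)⟩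
    have h1 : γ (Ideal.Quotient.mk _ x) = α x := RingHom.congr_fun hγ x
    have h2 : ρ (Ideal.Quotient.mk _ x) = β (α x) := RingHom.congr_fun hρ x
    have h3 : δ (Ideal.Quotient.mk _ (α x)) = β (α x) := RingHom.congr_fun hδ (α x)
    change δ.symm (ρ (Ideal.Quotient.mk _ x)) =
      Ideal.Quotient.mk _ (γ (Ideal.Quotient.mk _ x))
    rw [h1, h2, ← h3, RingEquiv.symm_apply_apply]
  · have hbij := bijOn_loc_idBar hS hfin dBar.left hnil
    have heq : Loc.ideal dBar.left (primeRadical (Rbar S hS.isOre)) =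
        primeRadical (Loc (Sbar S hS.isOre) dBar.left) :=
      le_antisymm (le_sInf fun Q hQ =>
        loc_primeRadical_le_of_isNilpotentIdeal hS hfin dBar.left hnil hQ) hrad
    obtain ⟨μ, hμ⟩ := exists_quotientEquiv hαs (hαk.trans heq)
    exact ⟨hbij, (bijOn_minPrimes_comap e).comp hbij, heq, Ideal.quotEquivOfEq heq, μ,
      RingHom.ext fun _ => rfl, hμ⟩
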